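/- Let $d>0$, let $f:\mathbb{R}\to\mathbb{R}$ be Lipschitz continuous with $f'$ compactly supported, and put $\Omega:=\mathbb{R}\times(0,d)$, $K(y):=e^{y^2/4}$, $E_1:=(\pi/d)^2$ and $\sigma_s(y):=e^{s/2}f'(e^{s/2}y)$. For $k\in\{0,1\}$ let $\mathcal{H}_k:=L^2(\Omega,K(y)^k\,dy\,dz)$ (complex-valued functions), and for $s\ge 0$ consider the following two quadratic forms. (1) In $\mathcal{H}_1$, $$J^{(1)}_s[w]=\|\partial_y w-\sigma_s\partial_z w\|^2_{\mathcal{H}_1}+e^s\|\partial_z w\|^2_{\mathcal{H}_1}-E_1e^s\|w\|^2_{\mathcal{H}_1}-\tfrac14\|w\|^2_{\mathcal{H}_1},$$ with domain the closure of $C_0^\infty(\Omega)$ in the norm $(\|w\|^2_{\mathcal{H}_1}+\|\nabla w\|^2_{\mathcal{H}_1})^{1/2}$. (2) In $\mathcal{H}_0=L^2(\Omega)$, $$J^{(0)}_s[v]=\|\partial_y v-\sigma_s\partial_z v\|^2_{\mathcal{H}_0}+\tfrac1{16}\|yv\|^2_{\mathcal{H}_0}+e^s\|\partial_z v\|^2_{\mathcal{H}_0}-E_1e^s\|v\|^2_{\mathcal{H}_0},$$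 with domain the closure of $C_0^\infty(\Omega)$ in the norm $(\|v\|^2_{\mathcal{H}_0}+\|\nabla v\|^2_{\mathcal{H}_0}+\|yv\|^2_{\mathcal{H}_0})^{1/2}$. Let $T^{(k)}_s$ be the operator in $\mathcal{H}_k$ associated with $J^{(k)}_s$: $u\in\mathcal{D}(T^{(k)}_s)$ and $T^{(k)}_su=F$ if and only if $u$ is in the form domain and $J^{(k)}_s(v,u)=(v,F)_{\mathcal{H}_k}$ for all $v$ in the form domain. **Proposition.** For every $s\ge0$ the operators $T^{(1)}_s$ and $T^{(0)}_s$ are well defined and self-adjoint; the map $w\mapsto e^{y^2/8}w$ is a unitary operator $\mathcal{U}_0:\mathcal{H}_1\to\mathcal{H}_0$ with $T^{(0)}_s=\mathcal{U}_0T^{(1)}_s\mathcal{U}_0^{-1}$; and both $T^{(1)}_s$ and $T^{(0)}_s$ have compact resolvent and purely discrete spectrum, that is, the resolvent set is non-empty, every resolvent operator is compact, and every point of the spectrum is an isolated point of it and an eigenvalue of finite multiplicity. -/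

import Mathlib

open MeasureTheory
open scoped ENNReal NNReal Distributions LineDeriv

noncomputable section

namespace UnboundedOperator

variable {H : Type*} [NormedAddCommGroup H] [InnerProductSpace ℂ H]

/-- `R` is the (bounded, everywhere defined) resolvent `(T - z)⁻¹` of the operator `T` at `z`. -/
def IsResolvent (T : H →ₗ.[ℂ] H) (z : ℂ) (R : H →L[ℂ] H) : Prop :=
  (∀ x : H, ∃ h : R x ∈ T.domain, T ⟨R x, h⟩ - z • R x = x) ∧
    ∀ u : T.domain, R (T u - z • (u : H)) = u

/-- The resolvent set of an unbounded operator. -/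
def resolventSet (T : H →ₗ.[ℂ] H) : Set ℂ := {z | ∃ R : H →L[ℂ] H, IsResolvent T z R}

/-- The spectrum of an unbounded operator. -/
def spectrum (T : H →ₗ.[ℂ] H) : Set ℂ := (resolventSet T)ᶜ

/-- The geometric eigenspace `ker (T - z)`. -/
def eigenspace (T : H →ₗ.[ℂ] H) (z : ℂ) : Submodule ℂ H :=
  T.graph.comap (LinearMap.prod LinearMap.id (z • LinearMap.id))

/-- The discrete spectrum of a self-adjoint operator: the isolated points of the spectrum that are
eigenvalues of finite multiplicity. -/
def discreteSpectrum (T : H →ₗ.[ℂ] H) : Set ℂ :=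
  {z | z ∈ spectrum T ∧ (∃ ε > 0, ∀ w ∈ spectrum T, w ≠ z → ε ≤ dist w z) ∧
    eigenspace T z ≠ ⊥ ∧ FiniteDimensional ℂ (eigenspace T z)}

/-- The spectrum consists of isolated eigenvalues of finite multiplicity only. -/
def HasPurelyDiscreteSpectrum (T : H →ₗ.[ℂ] H) : Prop := spectrum T = discreteSpectrum T

/-- The resolvent set is non-empty and every resolvent operator is compact. -/
def HasCompactResolvent (T : H →ₗ.[ℂ] H) : Prop :=
  (resolventSet T).Nonempty ∧
    ∀ (z : ℂ) (R : H →L[ℂ] H), IsResolvent T z R → IsCompactOperator R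

variable {V : Type*} [AddCommGroup V] [Module ℂ V]

/-- The graph of the operator associated in `H` with a sesquilinear form `a` whose form domain `V`
is embedded in `H` by `j`: the pairs `(u, F)` such that `u` is in the form domain and
`a(v, u) = (v, F)` for all `v` in the form domain. -/
def formGraph (j : V →ₗ[ℂ] H) (a : V →ₗ⋆[ℂ] V →ₗ[ℂ] ℂ) : Submodule ℂ (H × H) where
  carrier := {x | ∃ u : V, j u = x.1 ∧ ∀ v : V, a v u = inner ℂ (j v) x.2}
  zero_mem' := ⟨0, by simp⟩
  add_mem' := by
    rintro x x' ⟨u, hu, h⟩ ⟨u', hu', h'⟩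
    exact ⟨u + u', by simp [hu, hu'], fun v => by simp [h, h']⟩
  smul_mem' := by
    rintro c x ⟨u, hu, h⟩
    exact ⟨c • u, by simp [hu], fun v => by simp [h]⟩

/-- The operator associated with a form by the first representation theorem. -/
def formOperator (j : V →ₗ[ℂ] H) (a : V →ₗ⋆[ℂ] V →ₗ[ℂ] ℂ) : H →ₗ.[ℂ] H :=
  (formGraph j a).toLinearPMap

end UnboundedOperator

namespace ShearedStrip

open UnboundedOperator

/-- The straight strip `Ω = ℝ × (0, d)`. -/
def strip (d : ℝ) : TopologicalSpace.Opens (ℝ × ℝ) :=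
  ⟨Set.univ ×ˢ Set.Ioo 0 d, isOpen_univ.prod isOpen_Ioo⟩

/-- The weight `K(y) = exp (y² / 4)`. -/
def K (y : ℝ) : ℝ := Real.exp (y ^ 2 / 4)

/-- The measure `K(y)ᵏ dy dz` on the strip. -/
def weightMeasure (d : ℝ) (k : ℤ) : Measure (ℝ × ℝ) :=
  (volume.restrict (strip d : Set (ℝ × ℝ))).withDensity fun p => ENNReal.ofReal (K p.1 ^ k)

instance (d : ℝ) (k : ℤ) : IsLocallyFiniteMeasure (weightMeasure d k) :=
  IsLocallyFiniteMeasure.withDensity_ofReal (by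
    have hK : Continuous fun p : ℝ × ℝ => K p.1 := by unfold K; fun_prop
    exact hK.zpow₀ k fun p => Or.inl (Real.exp_pos _).ne')

/-- The weighted space `𝓗_k = L²(Ω, K(y)ᵏ dy dz)` of complex-valued functions. -/
abbrev WeightedL2 (d : ℝ) (k : ℤ) : Type := Lp ℂ 2 (weightMeasure d k)

theorem memLp_mul_testFunction (d : ℝ) (k : ℤ) {g : ℝ × ℝ → ℂ} (hg : Continuous g)
    (φ : 𝓓(strip d, ℂ)) : MemLp (fun p => g p * φ p) 2 (weightMeasure d k) :=
  (hg.mul φ.continuous).memLp_of_hasCompactSupport φ.hasCompactSupport.mul_left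

/-- The linear map `φ ↦ g φ` from `C₀^∞(Ω)` to `𝓗_k`, for a continuous function `g`. -/
def mulTest (d : ℝ) (k : ℤ) (g : ℝ × ℝ → ℂ) (hg : Continuous g) :
    𝓓(strip d, ℂ) →ₗ[ℂ] WeightedL2 d k where
  toFun φ := (memLp_mul_testFunction d k hg φ).toLp _
  map_add' φ ψ := by
    rw [← MemLp.toLp_add]
    congr 1
    ext p
    simp [mul_add]
  map_smul' c φ := by
    rw [RingHom.id_apply, ← MemLp.toLp_const_smul]
    congr 1
    ext p
    simp [mul_left_comm]

/-- The inclusion of `C₀^∞(Ω)` in `𝓗_k`. -/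
def ofTest (d : ℝ) (k : ℤ) : 𝓓(strip d, ℂ) →ₗ[ℂ] WeightedL2 d k :=
  mulTest d k (fun _ => 1) continuous_const

/-- The partial derivative `∂_m φ` in the direction `m`, as a linear map on `C₀^∞(Ω)`. -/
def partialTest (d : ℝ) (m : ℝ × ℝ) : 𝓓(strip d, ℂ) →ₗ[ℂ] 𝓓(strip d, ℂ) where
  toFun φ := ∂_{m} φ
  map_add' φ ψ := map_add (TestFunction.lineDerivCLM ℂ m) φ ψ
  map_smul' c φ := map_smul (TestFunction.lineDerivCLM ℂ m) c φ

theorem partialTest_apply (d : ℝ) (m : ℝ × ℝ) (φ : 𝓓(strip d, ℂ)) (p : ℝ × ℝ) :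
    partialTest d m φ p = lineDeriv ℝ φ p m :=
  TestFunction.lineDerivCLM_apply_of_le (𝕜 := ℂ) le_top

/-- The weighted Sobolev space `𝓗¹_k = H¹₀(Ω, K(y)ᵏ dy dz)`: the closure of `C₀^∞(Ω)` in the norm
`(‖u‖² + ‖∇u‖²)^{1/2}` of `𝓗_k`. An element is the triple `(u, ∂_y u, ∂_z u)` of a function and its
weak derivatives, which are determined by `u`. -/
def Sobolev (d : ℝ) (k : ℤ) :
    Submodule ℂ (WeightedL2 d k × WeightedL2 d k × WeightedL2 d k) :=
  (LinearMap.range ((ofTest d k).prod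
    ((ofTest d k ∘ₗ partialTest d (1, 0)).prod
      (ofTest d k ∘ₗ partialTest d (0, 1))))).topologicalClosure

/-- The closure of `C₀^∞(Ω)` in the norm `(‖v‖² + ‖∇v‖² + ‖y v‖²)^{1/2}` of `𝓗_0`. An element is the
quadruple `(v, ∂_y v, ∂_z v, y v)`. -/
def OscillatorSobolev (d : ℝ) :
    Submodule ℂ (WeightedL2 d 0 × WeightedL2 d 0 × WeightedL2 d 0 × WeightedL2 d 0) :=
  (LinearMap.range ((ofTest d 0).prod
    ((ofTest d 0 ∘ₗ partialTest d (1, 0)).prod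
      ((ofTest d 0 ∘ₗ partialTest d (0, 1)).prod
        (mulTest d 0 (fun p => (p.1 : ℂ))
          (Complex.continuous_ofReal.comp continuous_fst)))))).topologicalClosure

/-- The inclusion `u ↦ u` of `𝓗¹_k` in `𝓗_k`. -/
def Sobolev.toL2 (d : ℝ) (k : ℤ) : Sobolev d k →ₗ[ℂ] WeightedL2 d k :=
  LinearMap.fst _ _ _ ∘ₗ (Sobolev d k).subtype

/-- `u ↦ ∂_y u`. -/
def Sobolev.dy (d : ℝ) (k : ℤ) : Sobolev d k →ₗ[ℂ] WeightedL2 d k :=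
  LinearMap.fst _ _ _ ∘ₗ LinearMap.snd _ _ _ ∘ₗ (Sobolev d k).subtype

/-- `u ↦ ∂_z u`. -/
def Sobolev.dz (d : ℝ) (k : ℤ) : Sobolev d k →ₗ[ℂ] WeightedL2 d k :=
  LinearMap.snd _ _ _ ∘ₗ LinearMap.snd _ _ _ ∘ₗ (Sobolev d k).subtype

/-- The inclusion `v ↦ v` in `𝓗_0`. -/
def OscillatorSobolev.toL2 (d : ℝ) : OscillatorSobolev d →ₗ[ℂ] WeightedL2 d 0 :=
  LinearMap.fst _ _ _ ∘ₗ (OscillatorSobolev d).subtype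

/-- `v ↦ ∂_y v`. -/
def OscillatorSobolev.dy (d : ℝ) : OscillatorSobolev d →ₗ[ℂ] WeightedL2 d 0 :=
  LinearMap.fst _ _ _ ∘ₗ LinearMap.snd _ _ _ ∘ₗ (OscillatorSobolev d).subtype

/-- `v ↦ ∂_z v`. -/
def OscillatorSobolev.dz (d : ℝ) : OscillatorSobolev d →ₗ[ℂ] WeightedL2 d 0 :=
  LinearMap.fst _ _ _ ∘ₗ LinearMap.snd _ _ _ ∘ₗ LinearMap.snd _ _ _ ∘ₗ
    (OscillatorSobolev d).subtype

/-- `v ↦ y v`. -/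
def OscillatorSobolev.mulY (d : ℝ) : OscillatorSobolev d →ₗ[ℂ] WeightedL2 d 0 :=
  LinearMap.snd _ _ _ ∘ₗ LinearMap.snd _ _ _ ∘ₗ LinearMap.snd _ _ _ ∘ₗ
    (OscillatorSobolev d).subtype

/-- The lowest Dirichlet eigenvalue `E₁ = (π / d)²` of the interval `(0, d)`. -/
def E₁ (d : ℝ) : ℝ := (Real.pi / d) ^ 2

/-- `σ_s(y) = exp (s/2) f'(exp (s/2) y)`. -/
def sigma (f : ℝ → ℝ) (s y : ℝ) : ℝ := Real.exp (s / 2) * deriv f (Real.exp (s / 2) * y)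

theorem memLp_sigma {L : ℝ≥0} {f : ℝ → ℝ} (hf : LipschitzWith L f) (s d : ℝ) (k : ℤ) :
    MemLp (fun p : ℝ × ℝ => (sigma f s p.1 : ℂ)) ∞ (weightMeasure d k) := by
  refine memLp_top_of_bound ?_ (Real.exp (s / 2) * L) (Filter.Eventually.of_forall fun p => ?_)
  · have h : Measurable fun p : ℝ × ℝ => sigma f s p.1 := by
      unfold sigma
      exact ((measurable_deriv f).comp (measurable_fst.const_mul _)).const_mul _
    exact (Complex.measurable_ofReal.comp h).aestronglyMeasurable
  · rw [Complex.norm_real, sigma, norm_mul, Real.norm_of_nonneg (Real.exp_pos _).le]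
    exact mul_le_mul_of_nonneg_left (norm_deriv_le_of_lipschitz hf) (Real.exp_pos _).le

/-- Multiplication by `σ_s(y)` on `𝓗_k`. -/
def mulSigma {L : ℝ≥0} {f : ℝ → ℝ} (hf : LipschitzWith L f) (s d : ℝ) (k : ℤ) :
    WeightedL2 d k →ₗ[ℂ] WeightedL2 d k where
  toFun u := ((memLp_sigma hf s d k).toLp _ : Lp ℂ ∞ (weightMeasure d k)) • u
  map_add' _ _ := Lp.add_smul _ _ _
  map_smul' c u := (Lp.smul_comm c _ u).symm

/-- The form
`J⁽¹⁾_s(v, w) = (∂_y v - σ_s ∂_z v, ∂_y w - σ_s ∂_z w) + eˢ (∂_z v, ∂_z w) - E₁ eˢ (v, w)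
- (v, w) / 4` with the inner product of `𝓗_1`, on the domain `𝓗¹_1`. -/
def J₁ {L : ℝ≥0} {f : ℝ → ℝ} (hf : LipschitzWith L f) (d s : ℝ) :
    Sobolev d 1 →ₗ⋆[ℂ] Sobolev d 1 →ₗ[ℂ] ℂ :=
  LinearMap.mk₂'ₛₗ (starRingEnd ℂ) (RingHom.id ℂ)
    (fun v w =>
      inner ℂ (Sobolev.dy d 1 v - mulSigma hf s d 1 (Sobolev.dz d 1 v))
          (Sobolev.dy d 1 w - mulSigma hf s d 1 (Sobolev.dz d 1 w))
        + (Real.exp s : ℂ) * inner ℂ (Sobolev.dz d 1 v) (Sobolev.dz d 1 w)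
        - (E₁ d * Real.exp s : ℂ) * inner ℂ (Sobolev.toL2 d 1 v) (Sobolev.toL2 d 1 w)
        - (1 / 4 : ℂ) * inner ℂ (Sobolev.toL2 d 1 v) (Sobolev.toL2 d 1 w))
    (fun v v' w => by simp only [map_add, inner_add_left, inner_sub_left]; ring)
    (fun c v w => by
      simp only [map_smul, inner_smul_left, inner_sub_left, smul_eq_mul]; ring)
    (fun v w w' => by simp only [map_add, inner_add_right, inner_sub_right]; ring)
    (fun c v w => by
      simp only [map_smul, inner_smul_right, inner_sub_right, smul_eq_mul, RingHom.id_apply]; ring)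

/-- The form
`J⁽⁰⁾_s(v, w) = (∂_y v - σ_s ∂_z v, ∂_y w - σ_s ∂_z w) + (y v, y w) / 16 + eˢ (∂_z v, ∂_z w)
- E₁ eˢ (v, w)` with the inner product of `𝓗_0`. -/
def J₀ {L : ℝ≥0} {f : ℝ → ℝ} (hf : LipschitzWith L f) (d s : ℝ) :
    OscillatorSobolev d →ₗ⋆[ℂ] OscillatorSobolev d →ₗ[ℂ] ℂ :=
  LinearMap.mk₂'ₛₗ (starRingEnd ℂ) (RingHom.id ℂ)
    (fun v w =>
      inner ℂ (OscillatorSobolev.dy d v - mulSigma hf s d 0 (OscillatorSobolev.dz d v))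
          (OscillatorSobolev.dy d w - mulSigma hf s d 0 (OscillatorSobolev.dz d w))
        + (1 / 16 : ℂ) * inner ℂ (OscillatorSobolev.mulY d v) (OscillatorSobolev.mulY d w)
        + (Real.exp s : ℂ) * inner ℂ (OscillatorSobolev.dz d v) (OscillatorSobolev.dz d w)
        - (E₁ d * Real.exp s : ℂ) *
            inner ℂ (OscillatorSobolev.toL2 d v) (OscillatorSobolev.toL2 d w))
    (fun v v' w => by simp only [map_add, inner_add_left, inner_sub_left]; ring)
    (fun c v w => by
      simp only [map_smul, inner_smul_left, inner_sub_left, smul_eq_mul]; ring)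
    (fun v w w' => by simp only [map_add, inner_add_right, inner_sub_right]; ring)
    (fun c v w => by
      simp only [map_smul, inner_smul_right, inner_sub_right, smul_eq_mul, RingHom.id_apply]; ring)

/-- The operator `T⁽¹⁾_s` in `𝓗_1` associated with `J⁽¹⁾_s`. -/
def T₁ {L : ℝ≥0} {f : ℝ → ℝ} (hf : LipschitzWith L f) (d s : ℝ) :
    WeightedL2 d 1 →ₗ.[ℂ] WeightedL2 d 1 :=
  formOperator (Sobolev.toL2 d 1) (J₁ hf d s)

/-- The operator `T⁽⁰⁾_s` in `𝓗_0` associated with `J⁽⁰⁾_s`. -/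
def T₀ {L : ℝ≥0} {f : ℝ → ℝ} (hf : LipschitzWith L f) (d s : ℝ) :
    WeightedL2 d 0 →ₗ.[ℂ] WeightedL2 d 0 :=
  formOperator (OscillatorSobolev.toL2 d) (J₀ hf d s)

end ShearedStrip

end

/-! The whole statement rests on one compact embedding. With `l = E₁ eˢ + 1`, the form `J⁽⁰⁾_s + l
(·,·)` has the quadratic form `‖v‖² + ‖∂_y v - σ_s ∂_z v‖² + eˢ ‖∂_z v‖² + ‖y v‖² / 16`. Since `σ_s`
is bounded, the triangular map `(v, v_y, v_z, y v) ↦ (v, v_y - σ_s v_z, exp (s/2) v_z, y v / 4)` has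
a bounded inverse, so the form domain becomes a Hilbert space `W` whose inner product is the shifted
form. If `C : W → 𝓗_0` is the embedding, the Riesz argument gives `(T + l)⁻¹ = C C*`. When `C` is
compact and injective with dense range, `C C*` is compact, symmetric and injective.
Self-adjointness, compact resolvent and discreteness are then read off from the Fredholm alternative
for this bounded operator (`formOperator_spec`).

Compactness of `C` is a Rellich estimate (`OscillatorSobolev.exists_norm_sq_toL2_le`). The term `‖y
v‖²` makes the mass at large `|y|` small. On the remaining rectangle, cut into small squares, the
Poincaré inequality bounds the mass by a small multiple of the gradient plus finitely many cell
integrals.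

For the weighted problem put `v = exp (y²/8) w`, so that `∂_y w` becomes `exp (-y²/8) (∂_y v - y v /
4)`. Integrating the cross terms by parts gives exactly `(v, v) / 4`, which cancels the last term of
`J⁽¹⁾_s`. The cross term with `σ_s` vanishes because `σ_s(y) y` does not depend on `z`
(`J₁_toWeighted`). The same identity with `σ_s` absent bounds `‖y v‖` by the weighted Sobolev norm
of `w`, hence the two form domains correspond (`toWeighted_surjective`), and the results for
`T⁽⁰⁾_s` carry over. -/

namespace UnboundedOperator

/-! ### Spectral theory of an operator with compact symmetric shifted inverse -/

section Resolvent

open Filter Topology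

variable {H : Type*} [NormedAddCommGroup H] [InnerProductSpace ℂ H]

/-- The operator `T` is `G⁻¹ - l`, that is, `G = (T + l)⁻¹`. -/
def IsShiftedInverse (T : H →ₗ.[ℂ] H) (l : ℝ) (G : H →L[ℂ] H) : Prop :=
  ∀ x F : H, (x, F) ∈ T.graph ↔ x = G (F + (l : ℂ) • x)

variable {T : H →ₗ.[ℂ] H} {G : H →L[ℂ] H} {l : ℝ}

/-- The two hypotheses are the two halves of the definition of a resolvent, with membership in the
graph of `T` expressed through `G`. -/
theorem IsShiftedInverse.isResolvent_of (hT : IsShiftedInverse T l G) {z : ℂ} {R : H →L[ℂ] H}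
    (h₁ : ∀ x, R x = G (x + (z + l) • R x))
    (h₂ : ∀ u F, u = G (F + (l : ℂ) • u) → R (F - z • u) = u) : IsResolvent T z R := by
  refine ⟨fun x => ?_, fun u => ?_⟩
  · have hx : (R x, x + z • R x) ∈ T.graph := by
      rw [hT, add_assoc, ← add_smul]
      exact h₁ x
    obtain ⟨y, hy, hy'⟩ := T.mem_graph_iff.1 hx
    dsimp only at hy hy'
    refine ⟨hy ▸ y.2, ?_⟩
    have : (⟨R x, hy ▸ y.2⟩ : T.domain) = y := Subtype.ext hy.symm
    rw [this, hy']
    simp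
  · exact h₂ u (T u) ((hT _ _).1 (T.mem_graph u))

theorem IsShiftedInverse.isResolvent (hT : IsShiftedInverse T l G) :
    IsResolvent T (-(l : ℂ)) G :=
  hT.isResolvent_of (fun x => by simp) fun u F h => by
    rw [neg_smul, sub_neg_eq_add]
    exact h.symm

/-- By the resolvent identity `R = G (1 + (z + l) R)`, every resolvent operator factors through the
compact `G`. -/
theorem IsShiftedInverse.hasCompactResolvent (hT : IsShiftedInverse T l G)
    (hG : IsCompactOperator G) : HasCompactResolvent T := by
  refine ⟨⟨_, G, hT.isResolvent⟩, fun z R hR => ?_⟩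
  have h : (R : H → H) = G ∘ (ContinuousLinearMap.id ℂ H + (z + l) • R) := by
    funext x
    obtain ⟨hx, hx'⟩ := hR.1 x
    have := (hT _ _).1 (T.mem_graph ⟨R x, hx⟩)
    rw [sub_eq_iff_eq_add.1 hx'] at this
    dsimp only at this
    rw [add_assoc, ← add_smul] at this
    exact this
  rw [h]
  exact hG.comp_clm _

theorem IsShiftedInverse.mem_eigenspace_iff (hT : IsShiftedInverse T l G) {z : ℂ}
    (hz : z + l ≠ 0) (u : H) :
    u ∈ eigenspace T z ↔ u ∈ Module.End.eigenspace (G : Module.End ℂ H) (z + l)⁻¹ := by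
  rw [Module.End.mem_eigenspace_iff]
  change (u, z • u) ∈ T.graph ↔ G u = _
  rw [hT, ← add_smul, map_smul, eq_inv_smul_iff₀ hz, eq_comm]

theorem IsShiftedInverse.add_ne_zero_of_mem_spectrum (hT : IsShiftedInverse T l G) {z : ℂ}
    (hz : z ∈ spectrum T) : z + l ≠ 0 := by
  intro h
  exact hz ⟨G, eq_neg_of_add_eq_zero_left h ▸ hT.isResolvent⟩

/-- Fredholm alternative for `G` at `(z + l)⁻¹`. If this number were in the resolvent set of `G`,
with inverse `A` of `(z + l)⁻¹ - G`, then `(z + l)⁻¹ A G` would be a resolvent of `T` at `z`. -/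
theorem IsShiftedInverse.hasEigenvalue_of_mem_spectrum [CompleteSpace H]
    (hT : IsShiftedInverse T l G)
    (hG : IsCompactOperator G) {z : ℂ} (hz : z ∈ spectrum T) :
    Module.End.HasEigenvalue (G : Module.End ℂ H) (z + l)⁻¹ := by
  have hz0 := hT.add_ne_zero_of_mem_spectrum hz
  refine (hG.hasEigenvalue_or_mem_resolventSet (inv_ne_zero hz0)).resolve_right fun h => hz ?_
  rw [_root_.spectrum.mem_resolventSet_iff] at h
  obtain ⟨S, hS⟩ := h
  set A : H →L[ℂ] H := ((S⁻¹ : (H →L[ℂ] H)ˣ) : H →L[ℂ] H)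
  have hl : ∀ x, (z + l)⁻¹ • A x - G (A x) = x := fun x => by
    have := congrArg (fun B : H →L[ℂ] H => B x) S.mul_inv
    rw [hS] at this
    simpa [Algebra.algebraMap_eq_smul_one] using this
  have hr : ∀ x, A ((z + l)⁻¹ • x - G x) = x := fun x => by
    have := congrArg (fun B : H →L[ℂ] H => B x) S.inv_mul
    rw [hS] at this
    simpa [Algebra.algebraMap_eq_smul_one] using this
  refine ⟨(z + l)⁻¹ • (A ∘L G), hT.isResolvent_of (fun x => ?_) fun u F hu => ?_⟩
  · have := hl (G x)
    rw [sub_eq_iff_eq_add] at this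
    simp only [_root_.smul_apply, ContinuousLinearMap.comp_apply, map_add, map_smul]
    rw [this, smul_inv_smul₀ hz0]
  · simp only [_root_.smul_apply, ContinuousLinearMap.comp_apply]
    have h2 : G (F - z • u) = u - (z + l) • G u := by
      nth_rw 2 [hu]
      rw [← map_smul, ← map_sub]
      congr 1
      module
    rw [h2, ← map_smul, smul_sub, inv_smul_smul₀ hz0, hr]

/-- On this closed subspace the compact operator `(z + l) G` is the identity, so Riesz's theorem
applies. -/
theorem IsShiftedInverse.finiteDimensional_eigenspace [CompleteSpace H]
    (hT : IsShiftedInverse T l G)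
    (hG : IsCompactOperator G) {z : ℂ} (hz : z + l ≠ 0) :
    FiniteDimensional ℂ (eigenspace T z) := by
  have hmem : ∀ u ∈ eigenspace T z, G u = (z + l)⁻¹ • u := fun u hu =>
    Module.End.mem_eigenspace_iff.1 ((hT.mem_eigenspace_iff hz u).1 hu)
  have hcl : IsClosed (eigenspace T z : Set H) := by
    have : (eigenspace T z : Set H) = {u | G u = (z + l)⁻¹ • u} := by
      ext u
      exact (hT.mem_eigenspace_iff hz u).trans Module.End.mem_eigenspace_iff
    rw [this]
    exact isClosed_eq G.continuous (continuous_const_smul _)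
  have hinv : ∀ u ∈ eigenspace T z, ((z + l) • G : H →L[ℂ] H) u ∈ eigenspace T z := by
    intro u hu
    rw [_root_.smul_apply, hmem u hu, smul_inv_smul₀ hz]
    exact hu
  have hc : IsCompactOperator (((z + l) • G : H →L[ℂ] H) : H →ₗ[ℂ] H) := hG.smul (z + l)
  refine FiniteDimensional.of_isCompactOperator_id (𝕜 := ℂ) ?_
  have hid : (((((z + l) • G : H →L[ℂ] H) : H →ₗ[ℂ] H).restrict hinv : _ → _)) = id := by
    funext u
    ext
    simp [LinearMap.restrict_apply, hmem u u.2, smul_inv_smul₀ hz]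
  exact hid ▸ hc.restrict (V := eigenspace T z) hinv hcl

/-- If spectral points `w n ≠ z` tended to `z`, unit eigenvectors `e n` would have a limit along a
subsequence, because `e n = (w n + l) G (e n)` and `G` is compact. The limit is a unit eigenvector
for `z`. By symmetry it is orthogonal to every `e n`, hence to itself. -/
theorem IsShiftedInverse.isolated [CompleteSpace H] (hT : IsShiftedInverse T l G)
    (hG : IsCompactOperator G) (hs : (G : H →ₗ[ℂ] H).IsSymmetric) {z : ℂ}
    (hz : z ∈ spectrum T) : ∃ ε > 0, ∀ w ∈ spectrum T, w ≠ z → ε ≤ dist w z := by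
  have hz0 := hT.add_ne_zero_of_mem_spectrum hz
  by_contra! hcon
  choose w hw hwz hd using fun n : ℕ => hcon (1 / ((n : ℝ) + 1)) (by positivity)
  have hwt : Tendsto w atTop (𝓝 z) := by
    rw [tendsto_iff_dist_tendsto_zero]
    exact squeeze_zero (fun _ => dist_nonneg) (fun n => (hd n).le)
      tendsto_one_div_add_atTop_nhds_zero_nat
  have he : ∀ n, ∃ e : H, ‖e‖ = 1 ∧
      e ∈ Module.End.eigenspace (G : Module.End ℂ H) (w n + l)⁻¹ := fun n => by
    obtain ⟨v, hv⟩ := (hT.hasEigenvalue_of_mem_spectrum hG (hw n)).exists_hasEigenvector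
    exact ⟨((‖v‖⁻¹ : ℝ) : ℂ) • v, by
      rw [norm_smul, Complex.norm_real, norm_inv, norm_norm,
        inv_mul_cancel₀ (norm_ne_zero_iff.2 hv.2)], Submodule.smul_mem _ _ hv.1⟩
  choose e he1 hee using he
  have heG : ∀ n, G (e n) = (w n + l)⁻¹ • e n := fun n => Module.End.mem_eigenspace_iff.1 (hee n)
  obtain ⟨K, hK, hK'⟩ := IsCompactOperator.image_closedBall_subset_compact
    (f := (G : H →ₗ[ℂ] H)) hG 1
  obtain ⟨g, -, ψ, hψ, hψg⟩ := hK.tendsto_subseq fun n => hK' ⟨e n, by simp [he1], rfl⟩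
  have hlim : Tendsto (fun n => e (ψ n)) atTop (𝓝 ((z + l) • g)) := by
    have h1 : Tendsto (fun n => (w (ψ n) + l) • G (e (ψ n))) atTop (𝓝 ((z + l) • g)) :=
      ((hwt.comp hψ.tendsto_atTop).add_const _).smul hψg
    refine h1.congr fun n => ?_
    rw [heG, smul_inv_smul₀ (hT.add_ne_zero_of_mem_spectrum (hw _))]
  have hGe : G ((z + l) • g) = g :=
    tendsto_nhds_unique ((G.continuous.tendsto _).comp hlim) hψg
  have hmem : (z + l) • g ∈ Module.End.eigenspace (G : Module.End ℂ H) (z + l)⁻¹ := by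
    rw [Module.End.mem_eigenspace_iff]
    simpa [inv_smul_smul₀ hz0] using hGe
  have horth : ∀ n, inner ℂ (e n) ((z + l) • g) = 0 := fun n =>
    hs.orthogonalFamily_eigenspaces (i := (w n + l)⁻¹) (j := (z + l)⁻¹)
      (fun h => hwz n (add_right_cancel (inv_injective h))) ⟨e n, hee n⟩ ⟨_, hmem⟩
  have h0 : inner ℂ ((z + l) • g) ((z + l) • g) = 0 :=
    tendsto_nhds_unique (hlim.inner tendsto_const_nhds) (by simp [horth])
  have h1 : ‖(z + l) • g‖ = 1 :=
    tendsto_nhds_unique hlim.norm (by simp [he1])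
  rw [inner_self_eq_zero] at h0
  simp [h0] at h1

theorem IsShiftedInverse.hasPurelyDiscreteSpectrum [CompleteSpace H]
    (hT : IsShiftedInverse T l G) (hG : IsCompactOperator G)
    (hs : (G : H →ₗ[ℂ] H).IsSymmetric) : HasPurelyDiscreteSpectrum T := by
  refine Set.Subset.antisymm (fun z hz => ?_) fun z hz => hz.1
  have hz0 := hT.add_ne_zero_of_mem_spectrum hz
  refine ⟨hz, hT.isolated hG hs hz, fun h => ?_, hT.finiteDimensional_eigenspace hG hz0⟩
  obtain ⟨v, hv⟩ := (hT.hasEigenvalue_of_mem_spectrum hG hz).exists_hasEigenvector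
  have := (hT.mem_eigenspace_iff hz0 v).2 hv.1
  rw [h, Submodule.mem_bot] at this
  exact hv.2 this

/-- The range of an injective symmetric `G` is dense, so the adjoint exists. Its graph is the
solution set of the same equation `y = G (y' + l y)`, by symmetry of `G` and reality of `l`. -/
theorem IsShiftedInverse.isSelfAdjoint [CompleteSpace H] (hT : IsShiftedInverse T l G)
    (hs : (G : H →ₗ[ℂ] H).IsSymmetric) (hi : Function.Injective G) : IsSelfAdjoint T := by
  have hs' : ∀ x y, inner ℂ (G x) y = inner ℂ x (G y) := hs
  -- The pairs `(G h, h - l G h)` lie in the graph; testing the adjoint relation on them alone is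
  -- enough.
  have hran : ∀ h : H, (G h, h - (l : ℂ) • G h) ∈ T.graph := fun h => by
    rw [hT, sub_add_cancel]
  have hdom : ∀ h : H, G h ∈ T.domain := fun h => T.mem_domain_of_mem_graph (hran h)
  have hdense : Dense (T.domain : Set H) := by
    rw [Submodule.dense_iff_topologicalClosure_eq_top,
      Submodule.topologicalClosure_eq_top_iff, Submodule.eq_bot_iff]
    intro x hx
    rw [Submodule.mem_orthogonal] at hx
    apply hi
    rw [map_zero]
    refine ext_inner_left ℂ fun y => ?_
    rw [inner_zero_right, ← hs', hx _ (hdom y)]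
  rw [LinearPMap.isSelfAdjoint_def]
  apply LinearPMap.eq_of_eq_graph
  rw [LinearPMap.adjoint_graph_eq_graph_adjoint hdense]
  ext ⟨y, y'⟩
  rw [Submodule.mem_adjoint_iff, hT]
  constructor
  · intro h
    refine ext_inner_left ℂ fun x => ?_
    have := h _ _ (hran x)
    dsimp only at this
    rw [inner_sub_left, inner_smul_left, Complex.conj_ofReal, hs', hs'] at this
    rw [map_add, map_smul, inner_add_right, inner_smul_right]
    linear_combination this
  · intro h a b hab
    rw [hT] at hab
    dsimp only
    have h1 := hs' (b + (l : ℂ) • a) (y' + (l : ℂ) • y)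
    rw [← hab, ← h] at h1
    simp only [inner_add_left, inner_add_right, inner_smul_left, inner_smul_right,
      Complex.conj_ofReal] at h1
    linear_combination -h1

end Resolvent

/-! ### The first representation theorem -/

section Form

variable {H : Type*} [NormedAddCommGroup H] [InnerProductSpace ℂ H] [CompleteSpace H]
  {V : Type*} [AddCommGroup V] [Module ℂ V]
  {W : Type*} [NormedAddCommGroup W] [InnerProductSpace ℂ W] [CompleteSpace W]

/-- In `W` the equation `a(v, u) = (j v, F)` for all `v` reads `(e v, e u) = (C (e v), F + l x)`
with `x = j u`. As `e` is onto, this means `e u = C* (F + l x)`. -/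
theorem mem_formGraph_iff {j : V →ₗ[ℂ] H} {a : V →ₗ⋆[ℂ] V →ₗ[ℂ] ℂ} (C : W →L[ℂ] H)
    (e : V ≃ₗ[ℂ] W) {l : ℝ} (hj : ∀ v, j v = C (e v))
    (ha : ∀ v u, a v u + l * inner ℂ (j v) (j u) = inner ℂ (e v) (e u)) (x F : H) :
    (x, F) ∈ formGraph j a ↔ x = (C ∘L ContinuousLinearMap.adjoint C) (F + (l : ℂ) • x) := by
  rw [ContinuousLinearMap.comp_apply]
  constructor
  · rintro ⟨u, rfl, hu⟩
    dsimp only at hu ⊢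
    rw [hj u]
    congr 1
    refine ext_inner_left ℂ fun w => ?_
    obtain ⟨v, rfl⟩ := e.surjective w
    rw [ContinuousLinearMap.adjoint_inner_right, ← ha, ← hj, ← hj, inner_add_right,
      inner_smul_right, hu]
  · intro hx
    have hjx : j (e.symm (ContinuousLinearMap.adjoint C (F + (l : ℂ) • x))) = x := by
      rw [hj, e.apply_symm_apply]
      exact hx.symm
    refine ⟨_, hjx, fun v => ?_⟩
    have h := ha v (e.symm (ContinuousLinearMap.adjoint C (F + (l : ℂ) • x)))
    rw [e.apply_symm_apply, ContinuousLinearMap.adjoint_inner_right, ← hj, hjx, inner_add_right,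
      inner_smul_right] at h
    exact add_right_cancel h

/-- The representation theorem for a form that becomes, after a shift, the inner product of a
Hilbert space densely and compactly embedded in `H`. -/
theorem formOperator_spec {j : V →ₗ[ℂ] H} {a : V →ₗ⋆[ℂ] V →ₗ[ℂ] ℂ} (C : W →L[ℂ] H)
    (e : V ≃ₗ[ℂ] W) {l : ℝ} (hj : ∀ v, j v = C (e v))
    (ha : ∀ v u, a v u + l * inner ℂ (j v) (j u) = inner ℂ (e v) (e u))
    (hC : IsCompactOperator C) (hi : Function.Injective j) (hd : DenseRange j) :
    ((formOperator j a).graph = formGraph j a ∧ IsSelfAdjoint (formOperator j a)) ∧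
      HasCompactResolvent (formOperator j a) ∧ HasPurelyDiscreteSpectrum (formOperator j a) := by
  set G : H →L[ℂ] H := C ∘L ContinuousLinearMap.adjoint C
  have hmem := mem_formGraph_iff C e hj ha
  have hgraph : (formOperator j a).graph = formGraph j a := by
    refine Submodule.toLinearPMap_graph_eq _ ?_
    rintro ⟨x, F⟩ ⟨u, hu, hF⟩ hx
    dsimp only at hu hF hx ⊢
    -- Single-valuedness: injectivity of `j` forces `u = 0`, and then `F` is orthogonal to the dense
    -- range of `j`.
    have hu0 : u = 0 := hi (by rw [hu, hx, map_zero])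
    refine hd.eq_zero_of_inner_right ℂ fun v => ?_
    rw [← hF, hu0, map_zero]
  have hCi : Function.Injective C := fun w w' h => by
    obtain ⟨v, rfl⟩ := e.surjective w
    obtain ⟨v', rfl⟩ := e.surjective w'
    rw [← hj, ← hj] at h
    rw [hi h]
  have hGi : Function.Injective G := by
    rw [injective_iff_map_eq_zero]
    intro x hx
    have hx' : ContinuousLinearMap.adjoint C x = 0 := hCi (by rw [map_zero]; exact hx)
    refine hd.eq_zero_of_inner_right ℂ fun v => ?_
    rw [hj, ← ContinuousLinearMap.adjoint_inner_right, hx', inner_zero_right]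
  have hGc : IsCompactOperator G := hC.comp_clm _
  have hGs : (G : H →ₗ[ℂ] H).IsSymmetric := fun x y => by
    change inner ℂ (C (ContinuousLinearMap.adjoint C x)) y =
      inner ℂ x (C (ContinuousLinearMap.adjoint C y))
    rw [← ContinuousLinearMap.adjoint_inner_right C, ← ContinuousLinearMap.adjoint_inner_left C]
  have hT : IsShiftedInverse (formOperator j a) l G := fun x F => by rw [hgraph, hmem]
  exact ⟨⟨hgraph, hT.isSelfAdjoint hGs hGi⟩, hT.hasCompactResolvent hGc,
    hT.hasPurelyDiscreteSpectrum hGc hGs⟩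

end Form

/-! ### A compactness criterion -/

section Compactness

variable {W H : Type*} [NormedAddCommGroup W] [NormedSpace ℂ W] [NormedAddCommGroup H]
  [NormedSpace ℂ H] [CompleteSpace H]

/-- An operator which is arbitrarily small up to compact terms is compact. -/
theorem isCompactOperator_of_forall_norm_le (C : W →L[ℂ] H)
    (h : ∀ ε > 0, ∃ (ι : Type) (_ : Fintype ι) (K : W →L[ℂ] EuclideanSpace ℂ ι),
      ∀ w, ‖C w‖ ≤ ε * ‖w‖ + ‖K w‖) :
    IsCompactOperator C := by
  refine (isCompactOperator_iff_isCompact_closure_image_closedBall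
    (C : W →ₗ[ℂ] H) zero_lt_one).2 ?_
  refine (TotallyBounded.closure ?_).isCompact_of_isClosed isClosed_closure
  refine Metric.totallyBounded_iff.2 fun ε hε => ?_
  -- Two points of the unit ball differ by at most 2, so the final bound is `(ε/4) · 2 + ε/4 < ε`.
  obtain ⟨ι, _, K, hK⟩ := h (ε / 4) (by positivity)
  have hb : TotallyBounded (K '' Metric.closedBall 0 1) :=
    (K.lipschitz.isBounded_image Metric.isBounded_closedBall).isCompact_closure.totallyBounded.subset
      subset_closure
  obtain ⟨t, hts, htf, htc⟩ := Metric.finite_approx_of_totallyBounded hb (ε / 4) (by positivity)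
  obtain ⟨t', ht's, ht'f, rfl⟩ := Set.exists_subset_image_finite_and.1 ⟨t, hts, htf, rfl⟩
  refine ⟨C '' t', ht'f.image _, ?_⟩
  rintro _ ⟨w, hw, rfl⟩
  obtain ⟨_, ⟨w', hw', rfl⟩, hd⟩ := Set.mem_iUnion₂.1 (htc ⟨w, hw, rfl⟩)
  refine Set.mem_iUnion₂.2 ⟨C w', ⟨w', hw', rfl⟩, ?_⟩
  have h1 := hK (w - w')
  rw [map_sub, map_sub, ← dist_eq_norm (C w), ← dist_eq_norm (K w)] at h1
  have h2 : ‖w - w'‖ ≤ 2 := by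
    have := norm_sub_le w w'
    have h3 := ht's hw'
    rw [mem_closedBall_zero_iff] at hw h3
    linarith
  rw [Metric.mem_ball] at hd ⊢
  change dist (C w) (C w') < ε
  nlinarith

/-- The functionals are the coordinates of one map into Euclidean space; `a² + b² ≤ (a + b)²` for
nonnegative `a`, `b` reduces the squared bound to the unsquared one. -/
theorem isCompactOperator_of_forall_sq_norm_le (C : W →L[ℂ] H)
    (h : ∀ ε > 0, ∃ (ι : Type) (_ : Fintype ι) (K : ι → W →L[ℂ] ℂ),
      ∀ w, ‖C w‖ ^ 2 ≤ ε * ‖w‖ ^ 2 + ∑ i, ‖K i w‖ ^ 2) :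
    IsCompactOperator C := by
  refine isCompactOperator_of_forall_norm_le C fun ε hε => ?_
  obtain ⟨ι, _, K, hK⟩ := h (ε ^ 2) (by positivity)
  refine ⟨ι, inferInstance, (EuclideanSpace.equiv ι ℂ).symm.toContinuousLinearMap ∘L
    ContinuousLinearMap.pi K, fun w => ?_⟩
  refine abs_le_of_sq_le_sq' ?_ (by positivity) |>.2
  refine (hK w).trans ?_
  have h1 : ‖((EuclideanSpace.equiv ι ℂ).symm.toContinuousLinearMap ∘L
      ContinuousLinearMap.pi K) w‖ ^ 2 = ∑ i, ‖K i w‖ ^ 2 := by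
    rw [EuclideanSpace.norm_sq_eq]
    rfl
  rw [← h1]
  have : 0 ≤ ε * ‖w‖ * ‖((EuclideanSpace.equiv ι ℂ).symm.toContinuousLinearMap ∘L
      ContinuousLinearMap.pi K) w‖ := by positivity
  linarith

end Compactness

end UnboundedOperator

/-! ### Poincaré inequalities on intervals and subdivided rectangles -/

namespace CellPoincare

/-- Cauchy–Schwarz, from the nonnegativity of the integrated squared deviation from the mean `M /
h`. -/
theorem sq_integral_le {φ : ℝ → ℝ} (hφ : Continuous φ) {a h : ℝ} (hh : 0 < h) :
    (∫ x in a..a + h, φ x) ^ 2 ≤ h * ∫ x in a..a + h, φ x ^ 2 := by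
  set M := ∫ x in a..a + h, φ x with hM
  have h0 : 0 ≤ ∫ x in a..a + h, (φ x - M / h) ^ 2 :=
    intervalIntegral.integral_nonneg (by linarith) fun x _ => sq_nonneg _
  have h1 : ∫ x in a..a + h, (φ x - M / h) ^ 2 = (∫ x in a..a + h, φ x ^ 2) - M ^ 2 / h := by
    have : ∀ x, (φ x - M / h) ^ 2 = φ x ^ 2 - (2 * M / h) * φ x + M ^ 2 / h ^ 2 := fun x => by
      field_simp
      ring
    simp_rw [this]
    rw [intervalIntegral.integral_add, intervalIntegral.integral_sub,
      intervalIntegral.integral_const_mul, ← hM, intervalIntegral.integral_const]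
    · simp only [add_sub_cancel_left, smul_eq_mul]
      field_simp
      ring
    all_goals exact Continuous.intervalIntegrable (by fun_prop) _ _
  rw [h1, sub_nonneg, div_le_iff₀ hh] at h0
  linarith

/-- The Poincaré inequality on an interval of length `h`. -/
theorem interval {g g' : ℝ → ℂ} (hg : ∀ x, HasDerivAt g (g' x) x) (hg' : Continuous g')
    {a h : ℝ} (hh : 0 < h) :
    ∫ x in a..a + h, ‖g x‖ ^ 2 ≤
      2 * h ^ 2 * (∫ x in a..a + h, ‖g' x‖ ^ 2) + 2 / h * ‖∫ x in a..a + h, g x‖ ^ 2 := by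
  have hgc : Continuous g := continuous_iff_continuousAt.2 fun x => (hg x).continuousAt
  set M := ∫ x in a..a + h, ‖g' x‖ with hM
  set D := ∫ x in a..a + h, ‖g' x‖ ^ 2 with hD
  have hMD : M ^ 2 ≤ h * D := sq_integral_le hg'.norm hh
  have hM0 : 0 ≤ M := intervalIntegral.integral_nonneg (by linarith) fun _ _ => norm_nonneg _
  have hle : a ≤ a + h := by linarith
  have hint : ∀ b c : ℝ, IntervalIntegrable g' volume b c := fun b c => hg'.intervalIntegrable _ _
  have hdiff : ∀ x ∈ Set.Icc a (a + h), ∀ t ∈ Set.Icc a (a + h), ‖g x - g t‖ ≤ M := by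
    intro x hx t ht
    rw [← intervalIntegral.integral_eq_sub_of_hasDerivAt (fun y _ => hg y) (hint t x)]
    refine intervalIntegral.norm_integral_le_integral_norm_uIoc.trans ?_
    rw [hM, intervalIntegral.integral_of_le hle]
    refine setIntegral_mono_set ?_ (Filter.Eventually.of_forall fun _ => norm_nonneg _) ?_
    · exact (hg'.norm.intervalIntegrable a (a + h)).1
    · exact (Set.Ioc_subset_Ioc (le_min ht.1 hx.1) (max_le ht.2 hx.2)).eventuallyLE
  -- The value `g x` differs from the mean of `g` by at most `M = ∫ ‖g'‖`; then `(M + I/h)² ≤ 2 M² +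
  -- 2 (I/h)²` and `M² ≤ h D`.
  have hpt : ∀ x ∈ Set.Icc a (a + h),
      ‖g x‖ ^ 2 ≤ 2 * h * D + 2 / h ^ 2 * ‖∫ t in a..a + h, g t‖ ^ 2 := by
    intro x hx
    have h1 : ‖∫ t in a..a + h, (g x - g t)‖ ≤ M * |a + h - a| :=
      intervalIntegral.norm_integral_le_of_norm_le_const fun t ht => by
        rw [Set.uIoc_of_le hle] at ht
        exact hdiff x hx t ⟨ht.1.le, ht.2⟩
    rw [intervalIntegral.integral_sub (by simp) (hgc.intervalIntegrable _ _),
      intervalIntegral.integral_const, add_sub_cancel_left, abs_of_pos hh] at h1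
    have h2 : h * ‖g x‖ ≤ M * h + ‖∫ t in a..a + h, g t‖ := by
      have h3 := norm_sub_norm_le (h • g x) (∫ t in a..a + h, g t)
      rw [norm_smul, Real.norm_of_nonneg hh.le] at h3
      linarith
    set I := ‖∫ t in a..a + h, g t‖
    have hI : 0 ≤ I := norm_nonneg _
    have h4 : ‖g x‖ ≤ M + I / h := by
      rw [← mul_le_mul_iff_right₀ hh]
      calc h * ‖g x‖ ≤ M * h + I := h2
        _ = h * (M + I / h) := by field_simp
    calc ‖g x‖ ^ 2 ≤ (M + I / h) ^ 2 := by gcongr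
      _ ≤ 2 * M ^ 2 + 2 * (I / h) ^ 2 := by nlinarith [sq_nonneg (M - I / h)]
      _ ≤ 2 * (h * D) + 2 * (I / h) ^ 2 := by gcongr
      _ = _ := by ring
  have hfin : ∫ x in a..a + h, ‖g x‖ ^ 2 ≤
      ∫ _ in a..a + h, (2 * h * D + 2 / h ^ 2 * ‖∫ t in a..a + h, g t‖ ^ 2) :=
    intervalIntegral.integral_mono_on hle ((hgc.norm.pow 2).intervalIntegrable _ _) (by simp) hpt
  refine hfin.trans_eq ?_
  rw [intervalIntegral.integral_const, add_sub_cancel_left, smul_eq_mul]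
  field_simp

theorem sum_integral_cells {E : Type*} [NormedAddCommGroup E] [NormedSpace ℝ E] {φ : ℝ → E}
    (hφ : Continuous φ) (a h : ℝ) (n : ℕ) :
    ∑ i ∈ Finset.range n, ∫ x in (a + i * h)..(a + i * h + h), φ x =
      ∫ x in a..a + n * h, φ x := by
  have := intervalIntegral.sum_integral_adjacent_intervals (μ := volume) (f := φ)
    (a := fun i : ℕ => a + i * h) (n := n) fun k _ => hφ.intervalIntegrable _ _
  simp only [Nat.cast_zero, zero_mul, add_zero] at this
  rw [← this]
  refine Finset.sum_congr rfl fun i _ => ?_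
  push_cast
  congr 1
  ring

theorem interval_cells {g g' : ℝ → ℂ} (hg : ∀ x, HasDerivAt g (g' x) x) (hg' : Continuous g')
    (a : ℝ) {h : ℝ} (hh : 0 < h) (n : ℕ) :
    ∫ x in a..a + n * h, ‖g x‖ ^ 2 ≤ 2 * h ^ 2 * (∫ x in a..a + n * h, ‖g' x‖ ^ 2) +
      2 / h * ∑ i ∈ Finset.range n, ‖∫ x in (a + i * h)..(a + i * h + h), g x‖ ^ 2 := by
  have hgc : Continuous g := continuous_iff_continuousAt.2 fun x => (hg x).continuousAt
  have h1 : Continuous fun x => ‖g x‖ ^ 2 := hgc.norm.pow 2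
  have h2 : Continuous fun x => ‖g' x‖ ^ 2 := hg'.norm.pow 2
  rw [← sum_integral_cells h1, ← sum_integral_cells h2,
    Finset.mul_sum, Finset.mul_sum, ← Finset.sum_add_distrib]
  exact Finset.sum_le_sum fun i _ => interval hg hg' hh

/-- The Poincaré inequality on a rectangle divided into `m * n` cells of size `k * h`. -/
theorem rectangle_cells {u uy uz : ℝ × ℝ → ℂ} (hu : Continuous u) (huy : Continuous uy)
    (huz : Continuous uz) (hdy : ∀ y z, HasDerivAt (fun t => u (t, z)) (uy (y, z)) y)
    (hdz : ∀ y z, HasDerivAt (fun t => u (y, t)) (uz (y, z)) z) {B : ℝ} (hB : ∀ p, ‖uy p‖ ≤ B)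
    (a b : ℝ) {h k : ℝ} (hh : 0 < h) (hk : 0 < k) (m n : ℕ) :
    ∫ y in a..a + m * k, ∫ z in b..b + n * h, ‖u (y, z)‖ ^ 2 ≤
      2 * h ^ 2 * (∫ y in a..a + m * k, ∫ z in b..b + n * h, ‖uz (y, z)‖ ^ 2) +
      4 * k ^ 2 * (∫ y in a..a + m * k, ∫ z in b..b + n * h, ‖uy (y, z)‖ ^ 2) +
      4 / (h * k) * ∑ j ∈ Finset.range n, ∑ i ∈ Finset.range m,
        ‖∫ y in (a + i * k)..(a + i * k + k),
          ∫ z in (b + j * h)..(b + j * h + h), u (y, z)‖ ^ 2 := by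
  have hpar : ∀ {E : Type} [NormedAddCommGroup E] [NormedSpace ℝ E] {φ : ℝ × ℝ → E},
      Continuous φ → ∀ c c', Continuous fun y => ∫ z in c..c', φ (y, z) := fun {_} _ _ φ hφ c c' =>
    intervalIntegral.continuous_parametric_intervalIntegral_of_continuous'
      (f := fun y z => φ (y, z)) hφ c c'
  have hab : a ≤ a + m * k := by
    have : 0 ≤ (m : ℝ) * k := by positivity
    linarith
  have hNu : Continuous fun p => ‖u p‖ ^ 2 := hu.norm.pow 2
  have hNuy : Continuous fun p => ‖uy p‖ ^ 2 := huy.norm.pow 2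
  have hNuz : Continuous fun p => ‖uz p‖ ^ 2 := huz.norm.pow 2
  -- `G j` integrates out `z` over the `j`-th row. The inequality is applied in `z` on every slice
  -- and then in `y` to each `G j`.
  set G : ℕ → ℝ → ℂ := fun j y => ∫ z in (b + j * h)..(b + j * h + h), u (y, z) with hG
  set G' : ℕ → ℝ → ℂ := fun j y => ∫ z in (b + j * h)..(b + j * h + h), uy (y, z) with hG'
  have hGc : ∀ j, Continuous (G j) := fun j => hpar hu _ _
  have hG'c : ∀ j, Continuous (G' j) := fun j => hpar huy _ _
  -- Differentiation under the integral sign, with the global bound `B` on `uy` as dominating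
  -- function.
  have hGd : ∀ j y, HasDerivAt (G j) (G' j y) y := fun j y =>
    (intervalIntegral.hasDerivAt_integral_of_dominated_loc_of_deriv_le
      (F := fun y z => u (y, z)) (F' := fun y z => uy (y, z)) (bound := fun _ => B)
      (s := Set.univ) Filter.univ_mem
      (Filter.Eventually.of_forall fun x =>
        (hu.comp (Continuous.prodMk_right x)).aestronglyMeasurable)
      ((hu.comp (Continuous.prodMk_right y)).intervalIntegrable _ _)
      (huy.comp (Continuous.prodMk_right y)).aestronglyMeasurable
      (Filter.Eventually.of_forall fun z _ x _ => hB _) (by simp)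
      (Filter.Eventually.of_forall fun z _ x _ => hdy x z)).2
  have hz : ∫ y in a..a + m * k, ∫ z in b..b + n * h, ‖u (y, z)‖ ^ 2 ≤
      2 * h ^ 2 * (∫ y in a..a + m * k, ∫ z in b..b + n * h, ‖uz (y, z)‖ ^ 2) +
      2 / h * ∑ j ∈ Finset.range n, ∫ y in a..a + m * k, ‖G j y‖ ^ 2 := by
    have hGsq : ∀ j, Continuous fun y => ‖G j y‖ ^ 2 := fun j => (hGc j).norm.pow 2
    have hsum : Continuous fun y => ∑ j ∈ Finset.range n, ‖G j y‖ ^ 2 :=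
      continuous_finsetSum _ fun j _ => (hGc j).norm.pow 2
    rw [← intervalIntegral.integral_finsetSum fun j _ =>
        (hGsq j).intervalIntegrable _ _,
      ← intervalIntegral.integral_const_mul, ← intervalIntegral.integral_const_mul,
      ← intervalIntegral.integral_add
        (((hpar hNuz _ _).const_mul _).intervalIntegrable _ _)
        ((hsum.const_mul _).intervalIntegrable _ _)]
    refine intervalIntegral.integral_mono hab ((hpar hNu _ _).intervalIntegrable _ _)
      ((((hpar hNuz _ _).const_mul _).add (hsum.const_mul _)).intervalIntegrable _ _) fun y => ?_
    exact interval_cells (hdz y) (huz.comp (Continuous.prodMk_right y)) b hh n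
  have hy : ∀ j, ∫ y in a..a + m * k, ‖G j y‖ ^ 2 ≤
      2 * k ^ 2 * (h * ∫ y in a..a + m * k,
        ∫ z in (b + j * h)..(b + j * h + h), ‖uy (y, z)‖ ^ 2) +
      2 / k * ∑ i ∈ Finset.range m, ‖∫ y in (a + i * k)..(a + i * k + k), G j y‖ ^ 2 := by
    intro j
    refine (interval_cells (hGd j) (hG'c j) a hk m).trans ?_
    gcongr
    rw [← intervalIntegral.integral_const_mul]
    refine intervalIntegral.integral_mono hab (((hG'c j).norm.pow 2).intervalIntegrable _ _)
      (((hpar hNuy _ _).const_mul _).intervalIntegrable _ _) fun y => ?_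
    have h1 := sq_integral_le (huy.comp (Continuous.prodMk_right y)).norm hh (a := b + j * h)
    refine le_trans ?_ h1
    gcongr
    exact intervalIntegral.norm_integral_le_integral_norm (by linarith)
  have hcells : ∑ j ∈ Finset.range n, ∫ y in a..a + m * k,
      ∫ z in (b + j * h)..(b + j * h + h), ‖uy (y, z)‖ ^ 2 =
      ∫ y in a..a + m * k, ∫ z in b..b + n * h, ‖uy (y, z)‖ ^ 2 := by
    rw [← intervalIntegral.integral_finsetSum fun j _ =>
      (hpar hNuy _ _).intervalIntegrable _ _]
    refine intervalIntegral.integral_congr fun y _ => ?_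
    exact sum_integral_cells (hNuy.comp (Continuous.prodMk_right y)) b h n
  -- The factors combine as `(2/h) · 2k² · h = 4k²` and `(2/h) · (2/k) = 4/(hk)`.
  have hfin := calc 2 / h * ∑ j ∈ Finset.range n, ∫ y in a..a + m * k, ‖G j y‖ ^ 2
      ≤ 2 / h * ∑ j ∈ Finset.range n, (2 * k ^ 2 * (h * ∫ y in a..a + m * k,
          ∫ z in (b + j * h)..(b + j * h + h), ‖uy (y, z)‖ ^ 2) +
        2 / k * ∑ i ∈ Finset.range m, ‖∫ y in (a + i * k)..(a + i * k + k), G j y‖ ^ 2) :=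
        mul_le_mul_of_nonneg_left (Finset.sum_le_sum fun j _ => hy j) (by positivity)
    _ = 4 * k ^ 2 * (∫ y in a..a + m * k, ∫ z in b..b + n * h, ‖uy (y, z)‖ ^ 2) +
        4 / (h * k) * ∑ j ∈ Finset.range n, ∑ i ∈ Finset.range m,
          ‖∫ y in (a + i * k)..(a + i * k + k), G j y‖ ^ 2 := by
        rw [Finset.sum_add_distrib, ← Finset.mul_sum, ← Finset.mul_sum, ← Finset.mul_sum, hcells]
        field_simp
        ring
  linarith

end CellPoincare

/-! ### Test functions, weak derivatives and integration by parts on the oscillator domain -/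

namespace ShearedStrip

open UnboundedOperator
open scoped ComplexConjugate

theorem weightMeasure_zero (d : ℝ) :
    weightMeasure d 0 = volume.restrict (strip d : Set (ℝ × ℝ)) := by
  simp [weightMeasure]

theorem measurableSet_strip (d : ℝ) : MeasurableSet (strip d : Set (ℝ × ℝ)) :=
  (strip d).isOpen.measurableSet

theorem coeFn_mulTest (d : ℝ) (k : ℤ) {g : ℝ × ℝ → ℂ} (hg : Continuous g) (φ : 𝓓(strip d, ℂ)) :
    mulTest d k g hg φ =ᵐ[weightMeasure d k] fun p => g p * φ p :=
  MemLp.coeFn_toLp (memLp_mul_testFunction d k hg φ)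

theorem coeFn_ofTest (d : ℝ) (k : ℤ) (φ : 𝓓(strip d, ℂ)) :
    ofTest d k φ =ᵐ[weightMeasure d k] φ :=
  (coeFn_mulTest d k continuous_const φ).trans (Filter.Eventually.of_forall fun _ => one_mul _)

theorem testFunction_eq_zero {d : ℝ} (φ : 𝓓(strip d, ℂ)) {p : ℝ × ℝ} (hp : p ∉ strip d) :
    φ p = 0 :=
  image_eq_zero_of_notMem_tsupport fun h => hp (φ.tsupport_subset h)

theorem coeFn_mulSigma {L : ℝ≥0} {f : ℝ → ℝ} (hf : LipschitzWith L f) (s d : ℝ) (k : ℤ)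
    (u : WeightedL2 d k) :
    mulSigma hf s d k u =ᵐ[weightMeasure d k] fun p => (sigma f s p.1 : ℂ) * u p := by
  filter_upwards [Lp.coeFn_lpSMul (r := 2) ((memLp_sigma hf s d k).toLp _) u,
    (memLp_sigma hf s d k).coeFn_toLp] with p h1 h2
  change (((memLp_sigma hf s d k).toLp _ : Lp ℂ ∞ (weightMeasure d k)) • u : WeightedL2 d k) p = _
  rw [h1, Pi.smul_apply', h2, smul_eq_mul]

theorem continuous_mulSigma {L : ℝ≥0} {f : ℝ → ℝ} (hf : LipschitzWith L f) (s d : ℝ) (k : ℤ) :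
    Continuous (mulSigma hf s d k) := by
  refine AddMonoidHomClass.continuous_of_bound (mulSigma hf s d k)
    ‖(memLp_sigma hf s d k).toLp _‖ fun u => ?_
  exact Lp.norm_smul_le _ _

/-- Since the integrand vanishes off the strip, it may be integrated over the whole plane, where
integration by parts leaves no boundary terms. -/
theorem inner_eq_integral {d : ℝ} {f g : WeightedL2 d 0} {F G : ℝ × ℝ → ℂ}
    (hf : f =ᵐ[weightMeasure d 0] F) (hg : g =ᵐ[weightMeasure d 0] G)
    (h0 : ∀ p ∉ strip d, conj (F p) * G p = 0) :
    inner ℂ f g = ∫ p, conj (F p) * G p := by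
  rw [L2.inner_def, ← setIntegral_eq_integral_of_forall_compl_eq_zero h0, ← weightMeasure_zero]
  refine integral_congr_ae ?_
  filter_upwards [hf, hg] with p h1 h2
  rw [h1, h2, RCLike.inner_apply']

theorem hasLineDerivAt_testFunction {d : ℝ} (φ : 𝓓(strip d, ℂ)) (m p : ℝ × ℝ) :
    HasLineDerivAt ℝ φ (partialTest d m φ p) p m := by
  rw [partialTest_apply]
  exact ((φ.contDiff.differentiable (by simp)) p).lineDifferentiableAt.hasLineDerivAt

/-- Integration by parts against a coefficient which is differentiable in the direction `m`. -/
theorem integral_mul_partialTest {d : ℝ} (φ ψ : 𝓓(strip d, ℂ)) (m : ℝ × ℝ) {c c' : ℝ × ℝ → ℂ}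
    (hc : LocallyIntegrable c) (hc' : LocallyIntegrable c')
    (hd : ∀ p, HasLineDerivAt ℝ c (c' p) p m) :
    (∫ p, c p * (conj (partialTest d m φ p) * ψ p)) +
      (∫ p, c p * (conj (φ p) * partialTest d m ψ p)) +
      ∫ p, c' p * (conj (φ p) * ψ p) = 0 := by
  have hint : ∀ {e : ℝ × ℝ → ℂ}, LocallyIntegrable e → ∀ φ ψ : 𝓓(strip d, ℂ),
      Integrable fun p => e p * (conj (φ p) * ψ p) := fun he φ ψ =>
    he.integrable_smul_right_of_hasCompactSupport (by fun_prop) ψ.hasCompactSupport.mul_left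
  have hsum : (fun p => c p * (conj (partialTest d m φ p) * ψ p +
      conj (φ p) * partialTest d m ψ p)) = fun p => c p * (conj (partialTest d m φ p) * ψ p) +
      c p * (conj (φ p) * partialTest d m ψ p) := by
    funext p
    ring
  have h := integral_bilinear_hasLineDerivAt_right_eq_neg_left_of_integrable (μ := volume)
    (f := c) (f' := c') (g := fun p => conj (φ p) * ψ p)
    (g' := fun p => conj (partialTest d m φ p) * ψ p + conj (φ p) * partialTest d m ψ p) (v := m)
    (B := ContinuousLinearMap.mul ℝ ℂ) (hint hc' φ ψ)
    (by
      simp only [ContinuousLinearMap.mul_apply']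
      rw [hsum]
      exact (hint hc _ _).add (hint hc _ _))
    (hint hc φ ψ) (fun p _ => hd p) (fun p _ => by
      have h1 : HasDerivAt (fun t : ℝ => φ (p + t • m)) (partialTest d m φ p) 0 :=
        hasLineDerivAt_testFunction φ m p
      have h2 : HasDerivAt (fun t : ℝ => ψ (p + t • m)) (partialTest d m ψ p) 0 :=
        hasLineDerivAt_testFunction ψ m p
      have h3 := h1.star.mul h2
      simp only [zero_smul, add_zero] at h3
      exact h3)
  simp only [ContinuousLinearMap.mul_apply'] at h
  rw [hsum, integral_add (hint hc _ _) (hint hc _ _)] at h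
  rw [h, neg_add_cancel]

/-- The inclusion of `C₀^∞(Ω)` in the form domain. -/
noncomputable def OscillatorSobolev.ofTest (d : ℝ) : 𝓓(strip d, ℂ) →ₗ[ℂ] OscillatorSobolev d :=
  LinearMap.codRestrict _ ((ShearedStrip.ofTest d 0).prod
    ((ShearedStrip.ofTest d 0 ∘ₗ partialTest d (1, 0)).prod
      ((ShearedStrip.ofTest d 0 ∘ₗ partialTest d (0, 1)).prod
        (mulTest d 0 (fun p => (p.1 : ℂ))
          (Complex.continuous_ofReal.comp continuous_fst)))))
    fun _ => Submodule.le_topologicalClosure _ ⟨_, rfl⟩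

theorem OscillatorSobolev.denseRange_ofTest (d : ℝ) : DenseRange (OscillatorSobolev.ofTest d) := by
  refine Subtype.dense_iff.2 fun x hx => ?_
  rw [← Set.range_comp]
  exact hx

theorem OscillatorSobolev.continuous_toL2 (d : ℝ) : Continuous (OscillatorSobolev.toL2 d) :=
  continuous_fst.comp continuous_subtype_val

theorem OscillatorSobolev.continuous_dy (d : ℝ) : Continuous (OscillatorSobolev.dy d) :=
  (continuous_fst.comp continuous_snd).comp continuous_subtype_val

theorem OscillatorSobolev.continuous_dz (d : ℝ) : Continuous (OscillatorSobolev.dz d) :=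
  (continuous_fst.comp (continuous_snd.comp continuous_snd)).comp continuous_subtype_val

theorem OscillatorSobolev.continuous_mulY (d : ℝ) : Continuous (OscillatorSobolev.mulY d) :=
  (continuous_snd.comp (continuous_snd.comp continuous_snd)).comp continuous_subtype_val

/-- An element orthogonal to all test functions integrates to zero against every real smooth
function compactly supported in the strip, hence vanishes almost everywhere. -/
theorem denseRange_ofTest (d : ℝ) : DenseRange (ofTest d 0) := by
  change Dense (LinearMap.range (ofTest d 0) : Set (WeightedL2 d 0))
  rw [Submodule.dense_iff_topologicalClosure_eq_top,
    Submodule.topologicalClosure_eq_top_iff, Submodule.eq_bot_iff]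
  intro u hu
  rw [Submodule.mem_orthogonal] at hu
  have hloc : LocallyIntegrable u (weightMeasure d 0) :=
    (Lp.memLp u).locallyIntegrable (by norm_num)
  have key := (strip d).isOpen.ae_eq_zero_of_integral_contDiff_smul_eq_zero
    (hloc.locallyIntegrableOn _) fun g hg hgc hgs => by
      let φ : 𝓓(strip d, ℂ) := ⟨fun p => (g p : ℂ), Complex.ofRealCLM.contDiff.comp hg,
        hgc.comp_left (g := ((↑) : ℝ → ℂ)) rfl,
        (tsupport_comp_subset (g := ((↑) : ℝ → ℂ)) rfl g).trans hgs⟩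
      have h := hu _ ⟨φ, rfl⟩
      rw [L2.inner_def] at h
      rw [← h]
      refine integral_congr_ae ?_
      filter_upwards [coeFn_ofTest d 0 φ] with p hp
      rw [hp, RCLike.inner_apply']
      change _ = conj (g p : ℂ) * u p
      rw [Complex.conj_ofReal]
      rfl
  rw [Lp.eq_zero_iff_ae_eq_zero]
  have hmem : ∀ᵐ p ∂weightMeasure d 0, p ∈ (strip d : Set (ℝ × ℝ)) := by
    rw [weightMeasure_zero]
    exact ae_restrict_mem (measurableSet_strip d)
  filter_upwards [key, hmem] with p h1 h2 using h1 h2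

theorem OscillatorSobolev.denseRange_toL2 (d : ℝ) : DenseRange (OscillatorSobolev.toL2 d) :=
  Dense.mono (by rintro _ ⟨φ, rfl⟩; exact ⟨OscillatorSobolev.ofTest d φ, rfl⟩)
    (ShearedStrip.denseRange_ofTest d)

theorem inner_ofTest_partialTest {d : ℝ} (m : ℝ × ℝ) (φ ψ : 𝓓(strip d, ℂ)) :
    inner ℂ (ofTest d 0 φ) (ofTest d 0 (partialTest d m ψ)) =
      -inner ℂ (ofTest d 0 (partialTest d m φ)) (ofTest d 0 ψ) := by
  rw [inner_eq_integral (coeFn_ofTest d 0 _) (coeFn_ofTest d 0 _)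
      fun p hp => by simp [testFunction_eq_zero _ hp],
    inner_eq_integral (coeFn_ofTest d 0 _) (coeFn_ofTest d 0 _)
      fun p hp => by simp [testFunction_eq_zero _ hp]]
  have h := integral_mul_partialTest φ ψ m (c := fun _ => 1) (c' := fun _ => 0)
    (locallyIntegrable_const _) (locallyIntegrable_const _)
    fun p => hasDerivAt_const _ _
  simp only [one_mul, zero_mul, integral_zero, add_zero] at h
  linear_combination h

/-- The second component is a weak derivative of the first: both sides are continuous in `v` and
agree on the dense test functions. -/
theorem OscillatorSobolev.inner_dy {d : ℝ} (φ : 𝓓(strip d, ℂ)) (v : OscillatorSobolev d) :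
    inner ℂ (ShearedStrip.ofTest d 0 φ) (OscillatorSobolev.dy d v) =
      -inner ℂ (ShearedStrip.ofTest d 0 (partialTest d (1, 0) φ)) (OscillatorSobolev.toL2 d v) := by
  refine (OscillatorSobolev.denseRange_ofTest d).induction_on v (isClosed_eq ?_ ?_) fun ψ => ?_
  · exact continuous_const.inner (OscillatorSobolev.continuous_dy d)
  · exact (continuous_const.inner (OscillatorSobolev.continuous_toL2 d)).neg
  · exact inner_ofTest_partialTest _ φ ψ

theorem OscillatorSobolev.inner_dz {d : ℝ} (φ : 𝓓(strip d, ℂ)) (v : OscillatorSobolev d) :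
    inner ℂ (ShearedStrip.ofTest d 0 φ) (OscillatorSobolev.dz d v) =
      -inner ℂ (ShearedStrip.ofTest d 0 (partialTest d (0, 1) φ)) (OscillatorSobolev.toL2 d v) := by
  refine (OscillatorSobolev.denseRange_ofTest d).induction_on v (isClosed_eq ?_ ?_) fun ψ => ?_
  · exact continuous_const.inner (OscillatorSobolev.continuous_dz d)
  · exact (continuous_const.inner (OscillatorSobolev.continuous_toL2 d)).neg
  · exact inner_ofTest_partialTest _ φ ψ

theorem continuous_fst_ofReal : Continuous fun p : ℝ × ℝ => (p.1 : ℂ) :=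
  Complex.continuous_ofReal.comp continuous_fst

theorem OscillatorSobolev.inner_mulY {d : ℝ} (φ : 𝓓(strip d, ℂ)) (v : OscillatorSobolev d) :
    inner ℂ (ShearedStrip.ofTest d 0 φ) (OscillatorSobolev.mulY d v) =
      inner ℂ (mulTest d 0 _ continuous_fst_ofReal φ) (OscillatorSobolev.toL2 d v) := by
  refine (OscillatorSobolev.denseRange_ofTest d).induction_on v (isClosed_eq ?_ ?_) fun ψ => ?_
  · exact continuous_const.inner (OscillatorSobolev.continuous_mulY d)
  · exact continuous_const.inner (OscillatorSobolev.continuous_toL2 d)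
  · change inner ℂ (ShearedStrip.ofTest d 0 φ) (mulTest d 0 _ continuous_fst_ofReal ψ) =
      inner ℂ (mulTest d 0 _ continuous_fst_ofReal φ) (ShearedStrip.ofTest d 0 ψ)
    rw [inner_eq_integral (coeFn_ofTest d 0 _) (coeFn_mulTest d 0 _ _)
        fun p hp => by simp [testFunction_eq_zero _ hp],
      inner_eq_integral (coeFn_mulTest d 0 _ _) (coeFn_ofTest d 0 _)
        fun p hp => by simp [testFunction_eq_zero _ hp]]
    congr 1
    funext p
    rw [map_mul, Complex.conj_ofReal]
    ring

/-- The weak derivatives and `y v` are determined by `v`. -/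
theorem OscillatorSobolev.toL2_injective (d : ℝ) :
    Function.Injective (OscillatorSobolev.toL2 d) := by
  rw [injective_iff_map_eq_zero]
  intro v hv
  have h1 : OscillatorSobolev.dy d v = 0 :=
    (ShearedStrip.denseRange_ofTest d).eq_zero_of_inner_right ℂ fun φ => by
      rw [OscillatorSobolev.inner_dy, hv, inner_zero_right, neg_zero]
  have h2 : OscillatorSobolev.dz d v = 0 :=
    (ShearedStrip.denseRange_ofTest d).eq_zero_of_inner_right ℂ fun φ => by
      rw [OscillatorSobolev.inner_dz, hv, inner_zero_right, neg_zero]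
  have h3 : OscillatorSobolev.mulY d v = 0 :=
    (ShearedStrip.denseRange_ofTest d).eq_zero_of_inner_right ℂ fun φ => by
      rw [OscillatorSobolev.inner_mulY, hv, inner_zero_right]
  exact Subtype.ext (Prod.ext hv (Prod.ext h1 (Prod.ext h2 h3)))

/-- Integration by parts in `y` with coefficient `y`; the term `(v, w)` comes from `∂_y y = 1`. It
is the source of the `1/4` in `J⁽¹⁾_s`. -/
theorem OscillatorSobolev.inner_dy_mulY {d : ℝ} (v w : OscillatorSobolev d) :
    inner ℂ (OscillatorSobolev.dy d v) (OscillatorSobolev.mulY d w) +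
      inner ℂ (OscillatorSobolev.mulY d v) (OscillatorSobolev.dy d w) +
      inner ℂ (OscillatorSobolev.toL2 d v) (OscillatorSobolev.toL2 d w) = 0 := by
  have hy := OscillatorSobolev.continuous_dy d
  have hm := OscillatorSobolev.continuous_mulY d
  have ht := OscillatorSobolev.continuous_toL2 d
  refine (OscillatorSobolev.denseRange_ofTest d).induction_on₂ (isClosed_eq ?_ continuous_const)
    (fun φ ψ => ?_) v w
  · exact (((hy.comp continuous_fst).inner (hm.comp continuous_snd)).add
      ((hm.comp continuous_fst).inner (hy.comp continuous_snd))).add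
      ((ht.comp continuous_fst).inner (ht.comp continuous_snd))
  · change inner ℂ (ShearedStrip.ofTest d 0 (partialTest d (1, 0) φ))
        (mulTest d 0 _ continuous_fst_ofReal ψ) +
      inner ℂ (mulTest d 0 _ continuous_fst_ofReal φ)
        (ShearedStrip.ofTest d 0 (partialTest d (1, 0) ψ)) +
      inner ℂ (ShearedStrip.ofTest d 0 φ) (ShearedStrip.ofTest d 0 ψ) = 0
    rw [inner_eq_integral (coeFn_ofTest d 0 _) (coeFn_mulTest d 0 _ _)
        fun p hp => by simp [testFunction_eq_zero _ hp],
      inner_eq_integral (coeFn_mulTest d 0 _ _) (coeFn_ofTest d 0 _)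
        fun p hp => by simp [testFunction_eq_zero _ hp],
      inner_eq_integral (coeFn_ofTest d 0 _) (coeFn_ofTest d 0 _)
        fun p hp => by simp [testFunction_eq_zero _ hp],
      ← integral_mul_partialTest φ ψ (1, 0) (c := fun p => (p.1 : ℂ)) (c' := fun _ => 1)
        continuous_fst_ofReal.locallyIntegrable (locallyIntegrable_const _) fun p => ?_]
    · congr 2
      · congr 1
        funext p
        ring
      · congr 1
        funext p
        rw [map_mul, Complex.conj_ofReal]
        ring
      · funext p
        ring
    · have h : HasDerivAt (fun t : ℝ => ((p.1 + t : ℝ) : ℂ)) 1 0 :=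
        ((hasDerivAt_id (0 : ℝ)).const_add p.1).ofReal_comp
      simpa [HasLineDerivAt] using h

theorem locallyIntegrable_sigma_mul {L : ℝ≥0} {f : ℝ → ℝ} (hf : LipschitzWith L f) (s : ℝ) :
    LocallyIntegrable fun p : ℝ × ℝ => (sigma f s p.1 : ℂ) * (p.1 : ℂ) := by
  have hm : Measurable (sigma f s) := by
    unfold sigma
    exact ((measurable_deriv f).comp (measurable_id.const_mul _)).const_mul _
  have hb : ∀ y, ‖sigma f s y‖ ≤ Real.exp (s / 2) * L := fun y => by
    rw [sigma, norm_mul, Real.norm_of_nonneg (Real.exp_pos _).le]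
    exact mul_le_mul_of_nonneg_left (norm_deriv_le_of_lipschitz hf) (Real.exp_pos _).le
  have hc : Continuous fun p : ℝ × ℝ => (Real.exp (s / 2) * L) * p.1 := by fun_prop
  refine hc.locallyIntegrable.mono ?_ (Filter.Eventually.of_forall fun p => ?_)
  · exact ((Complex.measurable_ofReal.comp (hm.comp measurable_fst)).mul
      continuous_fst_ofReal.measurable).aestronglyMeasurable
  · rw [norm_mul, norm_mul, Complex.norm_real, Complex.norm_real,
      Real.norm_of_nonneg (by positivity : 0 ≤ Real.exp (s / 2) * (L : ℝ))]
    exact mul_le_mul_of_nonneg_right (hb _) (norm_nonneg _)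

/-- The coefficient `σ_s(y) y` is constant in `z`, so integrating by parts in `z` produces no extra
term and needs no derivative of `σ_s`. -/
theorem OscillatorSobolev.inner_dz_mulY {L : ℝ≥0} {f : ℝ → ℝ} (hf : LipschitzWith L f) (s : ℝ)
    {d : ℝ} (v w : OscillatorSobolev d) :
    inner ℂ (mulSigma hf s d 0 (OscillatorSobolev.dz d v)) (OscillatorSobolev.mulY d w) +
      inner ℂ (OscillatorSobolev.mulY d v) (mulSigma hf s d 0 (OscillatorSobolev.dz d w)) = 0 := by
  have hz := (continuous_mulSigma hf s d 0).comp (OscillatorSobolev.continuous_dz d)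
  have hm := OscillatorSobolev.continuous_mulY d
  refine (OscillatorSobolev.denseRange_ofTest d).induction_on₂ (isClosed_eq ?_ continuous_const)
    (fun φ ψ => ?_) v w
  · exact ((hz.comp continuous_fst).inner (hm.comp continuous_snd)).add
      ((hm.comp continuous_fst).inner (hz.comp continuous_snd))
  · have hσ : ∀ φ : 𝓓(strip d, ℂ), mulSigma hf s d 0 (ShearedStrip.ofTest d 0 φ)
        =ᵐ[weightMeasure d 0] fun p => (sigma f s p.1 : ℂ) * φ p := fun φ => by
      filter_upwards [coeFn_mulSigma hf s d 0 (ShearedStrip.ofTest d 0 φ),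
        coeFn_ofTest d 0 φ] with p h1 h2
      rw [h1, h2]
    change inner ℂ (mulSigma hf s d 0 (ShearedStrip.ofTest d 0 (partialTest d (0, 1) φ)))
        (mulTest d 0 _ continuous_fst_ofReal ψ) +
      inner ℂ (mulTest d 0 _ continuous_fst_ofReal φ)
        (mulSigma hf s d 0 (ShearedStrip.ofTest d 0 (partialTest d (0, 1) ψ))) = 0
    rw [inner_eq_integral (hσ _) (coeFn_mulTest d 0 _ _)
        fun p hp => by simp [testFunction_eq_zero _ hp],
      inner_eq_integral (coeFn_mulTest d 0 _ _) (hσ _)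
        fun p hp => by simp [testFunction_eq_zero _ hp]]
    have h := integral_mul_partialTest φ ψ (0, 1)
      (c := fun p => (sigma f s p.1 : ℂ) * (p.1 : ℂ)) (c' := fun _ => 0)
      (locallyIntegrable_sigma_mul hf s) (locallyIntegrable_const _) fun p => by
        simpa [HasLineDerivAt] using hasDerivAt_const (0 : ℝ) ((sigma f s p.1 : ℂ) * (p.1 : ℂ))
    simp only [zero_mul, integral_zero, add_zero] at h
    rw [← h]
    congr 2
    · funext p
      rw [map_mul, Complex.conj_ofReal]
      ring
    · funext p
      rw [map_mul, Complex.conj_ofReal]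
      ring

end ShearedStrip

/-! ### Rellich's inequality on the strip -/

namespace ShearedStrip

open UnboundedOperator
open scoped ComplexConjugate

theorem norm_sq_eq_integral {d : ℝ} {f : WeightedL2 d 0} {F : ℝ × ℝ → ℂ}
    (hf : f =ᵐ[weightMeasure d 0] F) (h0 : ∀ p ∉ strip d, F p = 0) :
    ‖f‖ ^ 2 = ∫ p, ‖F p‖ ^ 2 := by
  have h := inner_eq_integral hf hf fun p hp => by rw [h0 p hp, mul_zero]
  rw [inner_self_eq_norm_sq_to_K] at h
  simp_rw [Complex.conj_mul'] at h
  have h' : (((‖f‖ ^ 2 : ℝ)) : ℂ) = ((∫ p, ‖F p‖ ^ 2 : ℝ) : ℂ) := by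
    rw [← integral_complex_ofReal]
    push_cast
    exact h
  exact_mod_cast h'

/-- The half-open rectangle `(a, a'] × (b, b']`. -/
def cell (a a' b b' : ℝ) : Set (ℝ × ℝ) := Set.Ioc a a' ×ˢ Set.Ioc b b'

theorem measurableSet_cell (a a' b b' : ℝ) : MeasurableSet (cell a a' b b') :=
  measurableSet_Ioc.prod measurableSet_Ioc

theorem weightMeasure_cell_ne_top (d : ℝ) (k : ℤ) (a a' b b' : ℝ) :
    weightMeasure d k (cell a a' b b') ≠ ∞ :=
  ((Metric.isBounded_Ioc a a').prod (Metric.isBounded_Ioc b b')).measure_lt_top.ne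

theorem setIntegral_cell {E : Type*} [NormedAddCommGroup E] [NormedSpace ℝ E] {φ : ℝ × ℝ → E}
    (hφ : Integrable φ) {a a' b b' : ℝ} (ha : a ≤ a') (hb : b ≤ b') :
    ∫ p in cell a a' b b', φ p = ∫ y in a..a', ∫ z in b..b', φ (y, z) := by
  rw [cell, Measure.volume_eq_prod, setIntegral_prod _ hφ.integrableOn,
    intervalIntegral.integral_of_le ha]
  simp_rw [intervalIntegral.integral_of_le hb]

/-- The indicator function of a cell. -/
noncomputable def cellIndicator (d a a' b b' : ℝ) : WeightedL2 d 0 :=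
  indicatorConstLp 2 (measurableSet_cell a a' b b') (weightMeasure_cell_ne_top d 0 a a' b b') 1

theorem inner_cellIndicator {d : ℝ} (φ : 𝓓(strip d, ℂ)) {a a' b b' : ℝ} (ha : a ≤ a')
    (hb : b ≤ b') : inner ℂ (cellIndicator d a a' b b') (ofTest d 0 φ) =
      ∫ y in a..a', ∫ z in b..b', φ (y, z) := by
  rw [cellIndicator, L2.inner_indicatorConstLp_one,
    ← setIntegral_cell (φ.continuous.integrable_of_hasCompactSupport φ.hasCompactSupport) ha hb,
    setIntegral_congr_ae (g := φ) (measurableSet_cell a a' b b')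
      ((coeFn_ofTest d 0 φ).mono fun p hp _ => hp),
    weightMeasure_zero, ← integral_indicator (measurableSet_cell a a' b b'),
    setIntegral_eq_integral_of_forall_compl_eq_zero, integral_indicator (measurableSet_cell _ _ _ _)]
  intro p hp
  classical
  rw [Set.indicator_apply, testFunction_eq_zero φ hp, ite_self]

theorem hasDerivAt_testFunction_fst {d : ℝ} (φ : 𝓓(strip d, ℂ)) (y z : ℝ) :
    HasDerivAt (fun t => φ (t, z)) (partialTest d (1, 0) φ (y, z)) y := by
  have h : HasDerivAt (fun t : ℝ => φ ((y, z) + t • ((1 : ℝ), (0 : ℝ))))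
    (partialTest d (1, 0) φ (y, z)) (y - y) := by
    rw [sub_self]
    exact hasLineDerivAt_testFunction φ (1, 0) (y, z)
  simpa using h.comp_sub_const y y

theorem hasDerivAt_testFunction_snd {d : ℝ} (φ : 𝓓(strip d, ℂ)) (y z : ℝ) :
    HasDerivAt (fun t => φ (y, t)) (partialTest d (0, 1) φ (y, z)) z := by
  have h : HasDerivAt (fun t : ℝ => φ ((y, z) + t • ((0 : ℝ), (1 : ℝ))))
    (partialTest d (0, 1) φ (y, z)) (z - z) := by
    rw [sub_self]
    exact hasLineDerivAt_testFunction φ (0, 1) (y, z)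
  simpa using h.comp_sub_const z z

theorem integrable_norm_sq {ψ : ℝ × ℝ → ℂ} (hψ : Continuous ψ) (hs : HasCompactSupport ψ) :
    Integrable fun p => ‖ψ p‖ ^ 2 := by
  have h : HasCompactSupport fun p => ‖ψ p‖ ^ 2 := by
    simp_rw [sq]
    exact hs.norm.mul_left
  exact (hψ.norm.pow 2).integrable_of_hasCompactSupport h

theorem integral_norm_sq_le_norm_sq {d : ℝ} (φ : 𝓓(strip d, ℂ)) {a a' b b' : ℝ} (ha : a ≤ a')
    (hb : b ≤ b') :
    ∫ y in a..a', ∫ z in b..b', ‖φ (y, z)‖ ^ 2 ≤ ‖ofTest d 0 φ‖ ^ 2 := by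
  rw [norm_sq_eq_integral (coeFn_ofTest d 0 φ) fun p hp => testFunction_eq_zero φ hp,
    ← setIntegral_cell (integrable_norm_sq φ.continuous φ.hasCompactSupport) ha hb]
  exact setIntegral_le_integral (integrable_norm_sq φ.continuous φ.hasCompactSupport)
    (Filter.Eventually.of_forall fun p => sq_nonneg _)

/-- In the strip but outside the rectangle one has `|y| ≥ M`, hence `1 ≤ y² / M²`. -/
theorem norm_sq_ofTest_le {d : ℝ} (hd : 0 < d) (φ : 𝓓(strip d, ℂ)) {M : ℝ} (hM : 0 < M) :
    ‖ofTest d 0 φ‖ ^ 2 ≤ (∫ y in (-M)..M, ∫ z in (0)..d, ‖φ (y, z)‖ ^ 2) +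
      (M ^ 2)⁻¹ * ‖mulTest d 0 _ continuous_fst_ofReal φ‖ ^ 2 := by
  have hcell := measurableSet_cell (-M) M 0 d
  have hi := integrable_norm_sq φ.continuous φ.hasCompactSupport
  have hi' : Integrable fun p : ℝ × ℝ => ‖(p.1 : ℂ) * φ p‖ ^ 2 :=
    integrable_norm_sq (continuous_fst_ofReal.mul φ.continuous) φ.hasCompactSupport.mul_left
  rw [norm_sq_eq_integral (coeFn_ofTest d 0 φ) fun p hp => testFunction_eq_zero φ hp,
    norm_sq_eq_integral (coeFn_mulTest d 0 _ φ) fun p hp => by simp [testFunction_eq_zero φ hp],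
    ← setIntegral_cell hi (by linarith) hd.le, ← integral_indicator hcell, ← integral_const_mul,
    ← integral_add (hi.indicator hcell) (hi'.const_mul _)]
  refine integral_mono hi ((hi.indicator hcell).add (hi'.const_mul _)) fun p => ?_
  dsimp only [Pi.add_apply]
  by_cases hp : p ∈ cell (-M) M 0 d
  · rw [Set.indicator_of_mem hp]
    have : 0 ≤ (M ^ 2)⁻¹ * ‖(p.1 : ℂ) * φ p‖ ^ 2 := by positivity
    linarith
  rw [Set.indicator_of_notMem hp, zero_add]
  by_cases hs : p ∈ strip d
  · have hz : p.2 ∈ Set.Ioo 0 d := hs.2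
    have hy : M ≤ |p.1| := by
      by_contra h
      rw [not_le, abs_lt] at h
      exact hp ⟨⟨h.1, h.2.le⟩, ⟨hz.1, hz.2.le⟩⟩
    rw [norm_mul, Complex.norm_real, mul_pow, ← mul_assoc, Real.norm_eq_abs]
    refine le_mul_of_one_le_left (sq_nonneg _) ?_
    rw [inv_mul_eq_div, one_le_div (by positivity)]
    gcongr
  · simp [testFunction_eq_zero φ hs]

/-- Rellich's inequality: the `L²` norm is controlled by a small multiple of the form norm and
finitely many functionals. -/
theorem OscillatorSobolev.exists_norm_sq_toL2_le {d : ℝ} (hd : 0 < d) {ε : ℝ} (hε : 0 < ε) :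
    ∃ (ι : Type) (_ : Fintype ι) (g : ι → WeightedL2 d 0), ∀ v : OscillatorSobolev d,
      ‖OscillatorSobolev.toL2 d v‖ ^ 2 ≤
        ε * (‖OscillatorSobolev.dy d v‖ ^ 2 + ‖OscillatorSobolev.dz d v‖ ^ 2 +
          ‖OscillatorSobolev.mulY d v‖ ^ 2) +
        ∑ i, ‖inner ℂ (g i) (OscillatorSobolev.toL2 d v)‖ ^ 2 := by
  -- A square mesh of side `h = d / n ≤ δ` makes both Poincaré constants `2h²` and `4h²` at most
  -- `ε`.
  obtain ⟨δ, hδ, hδε⟩ : ∃ δ : ℝ, 0 < δ ∧ 4 * δ ^ 2 ≤ ε :=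
    ⟨√ε / 2, by positivity, by rw [div_pow, Real.sq_sqrt hε.le]; linarith⟩
  obtain ⟨n, hn⟩ := exists_nat_gt (d / δ)
  have hn0 : (0 : ℝ) < n := (div_pos hd hδ).trans hn
  set h : ℝ := d / n with hh
  have hh0 : 0 < h := div_pos hd hn0
  have hnh : n * h = d := by rw [hh]; field_simp
  have hhδ : h ≤ δ := by
    rw [hh, div_le_iff₀ hn0]
    rw [div_lt_iff₀ hδ] at hn
    linarith
  have hhε : 4 * h ^ 2 ≤ ε := le_trans (by gcongr) hδε
  -- Half-width `m h > 1/δ`: the tail factor `(m h)⁻²` is then below `δ² ≤ ε`, and `2m` columns of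
  -- width `h` fill the rectangle exactly.
  obtain ⟨m, hm⟩ := exists_nat_gt (1 / (δ * h))
  have hm0 : (0 : ℝ) < m := lt_trans (by positivity) hm
  have hM0 : 0 < m * h := mul_pos hm0 hh0
  have hMε : ((m * h) ^ 2)⁻¹ ≤ ε := by
    have h1 : 1 ≤ δ * (m * h) := by
      rw [div_lt_iff₀ (by positivity)] at hm
      linarith
    rw [inv_le_iff_one_le_mul₀ (by positivity)]
    nlinarith [mul_pos hδ hM0, sq_nonneg (m * h)]
  set c : ℕ × ℕ → WeightedL2 d 0 := fun q => cellIndicator d (-(m * h) + q.2 * h)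
    (-(m * h) + q.2 * h + h) (0 + q.1 * h) (0 + q.1 * h + h) with hc
  -- The scaling `2 / h` squares to the factor `4 / (h * h)` of `rectangle_cells`.
  refine ⟨Fin n × Fin (2 * m), inferInstance, fun q => ((2 / h : ℝ) : ℂ) • c (q.1, q.2),
    fun v => ?_⟩
  have ht := OscillatorSobolev.continuous_toL2 d
  have hy := OscillatorSobolev.continuous_dy d
  have hz := OscillatorSobolev.continuous_dz d
  have hmy := OscillatorSobolev.continuous_mulY d
  refine (OscillatorSobolev.denseRange_ofTest d).induction_on v (isClosed_le ?_ ?_) fun φ => ?_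
  · exact ht.norm.pow 2
  · exact (continuous_const.mul (((hy.norm.pow 2).add (hz.norm.pow 2)).add (hmy.norm.pow 2))).add
      (continuous_finsetSum _ fun i _ => (continuous_const.inner ht).norm.pow 2)
  · change ‖ShearedStrip.ofTest d 0 φ‖ ^ 2 ≤ ε * (‖ShearedStrip.ofTest d 0 (partialTest d (1, 0) φ)‖ ^ 2 +
        ‖ShearedStrip.ofTest d 0 (partialTest d (0, 1) φ)‖ ^ 2 +
        ‖mulTest d 0 _ continuous_fst_ofReal φ‖ ^ 2) +
      ∑ q : Fin n × Fin (2 * m), ‖inner ℂ (((2 / h : ℝ) : ℂ) • c (q.1, q.2)) (ShearedStrip.ofTest d 0 φ)‖ ^ 2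
    obtain ⟨B, hB⟩ := (partialTest d (1, 0) φ).continuous.bounded_above_of_compact_support
      (partialTest d (1, 0) φ).hasCompactSupport
    have h1 := norm_sq_ofTest_le hd φ hM0
    have h2 := CellPoincare.rectangle_cells φ.continuous (partialTest d (1, 0) φ).continuous
      (partialTest d (0, 1) φ).continuous (hasDerivAt_testFunction_fst φ)
      (hasDerivAt_testFunction_snd φ) hB (-(m * h)) 0 hh0 hh0 (2 * m) n
    have hend : -(m * h) + ((2 * m : ℕ) : ℝ) * h = m * h := by push_cast; ring
    rw [hend, zero_add, hnh] at h2
    have h3 := integral_norm_sq_le_norm_sq (partialTest d (1, 0) φ)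
      (by linarith : -(m * h) ≤ m * h) hd.le
    have h4 := integral_norm_sq_le_norm_sq (partialTest d (0, 1) φ)
      (by linarith : -(m * h) ≤ m * h) hd.le
    have h5 : ∑ q : Fin n × Fin (2 * m),
        ‖inner ℂ (((2 / h : ℝ) : ℂ) • c (q.1, q.2)) (ShearedStrip.ofTest d 0 φ)‖ ^ 2 =
        4 / (h * h) * ∑ j ∈ Finset.range n, ∑ i ∈ Finset.range (2 * m),
          ‖∫ y in (-(m * h) + i * h)..(-(m * h) + i * h + h),
            ∫ z in (0 + j * h)..(0 + j * h + h), φ (y, z)‖ ^ 2 := by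
      rw [Fintype.sum_prod_type, Finset.sum_range, Finset.mul_sum]
      refine Finset.sum_congr rfl fun j _ => ?_
      rw [Finset.sum_range, Finset.mul_sum]
      refine Finset.sum_congr rfl fun i _ => ?_
      rw [inner_smul_left, hc, inner_cellIndicator φ (by linarith) (by linarith), norm_mul,
        Complex.conj_ofReal, Complex.norm_real, mul_pow, norm_div, div_pow]
      simp only [Real.norm_eq_abs, sq_abs]
      ring
    rw [h5]
    have h6 : 4 * h ^ 2 * (∫ y in (-(m * h))..(m * h), ∫ z in (0)..d,
        ‖partialTest d (1, 0) φ (y, z)‖ ^ 2) ≤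
        ε * ‖ShearedStrip.ofTest d 0 (partialTest d (1, 0) φ)‖ ^ 2 :=
      (mul_le_mul_of_nonneg_left h3 (by positivity)).trans
        (mul_le_mul_of_nonneg_right hhε (sq_nonneg _))
    have h7 : 2 * h ^ 2 * (∫ y in (-(m * h))..(m * h), ∫ z in (0)..d,
        ‖partialTest d (0, 1) φ (y, z)‖ ^ 2) ≤
        ε * ‖ShearedStrip.ofTest d 0 (partialTest d (0, 1) φ)‖ ^ 2 :=
      (mul_le_mul_of_nonneg_left h4 (by positivity)).trans
        (mul_le_mul_of_nonneg_right (by nlinarith [sq_nonneg h]) (sq_nonneg _))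
    have h8 := mul_le_mul_of_nonneg_right hMε
      (sq_nonneg ‖mulTest d 0 _ continuous_fst_ofReal φ‖)
    linarith

end ShearedStrip

/-! ### The energy space and its compact embedding -/

namespace ShearedStrip

open UnboundedOperator

/-- Multiplication by `σ_s` as a bounded operator. -/
noncomputable def mulSigmaCLM {L : ℝ≥0} {f : ℝ → ℝ} (hf : LipschitzWith L f) (s d : ℝ) :
    WeightedL2 d 0 →L[ℂ] WeightedL2 d 0 :=
  ⟨mulSigma hf s d 0, continuous_mulSigma hf s d 0⟩

/-- The Hilbert space in which the shifted form `J⁽⁰⁾_s` is the inner product. -/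
abbrev EnergySpace (d : ℝ) : Type := PiLp 2 fun _ : Fin 4 => WeightedL2 d 0

/-- `(v, v_y, v_z, y v) ↦ (v, v_y - σ_s v_z, exp (s / 2) v_z, y v / 4)`. -/
noncomputable def energyMap {L : ℝ≥0} {f : ℝ → ℝ} (hf : LipschitzWith L f) (s d : ℝ) :
    (WeightedL2 d 0 × WeightedL2 d 0 × WeightedL2 d 0 × WeightedL2 d 0) ≃L[ℂ] EnergySpace d where
  toFun x := WithLp.toLp 2 ![x.1, x.2.1 - mulSigmaCLM hf s d x.2.2.1,
    (Real.exp (s / 2) : ℂ) • x.2.2.1, (1 / 4 : ℂ) • x.2.2.2]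
  invFun y := (y 0, y 1 + mulSigmaCLM hf s d ((Real.exp (-(s / 2)) : ℂ) • y 2),
    (Real.exp (-(s / 2)) : ℂ) • y 2, (4 : ℂ) • y 3)
  map_add' x y := by
    ext i : 1
    fin_cases i
    · simp
    · simp only [Prod.fst_add, Prod.snd_add, map_add]
      exact add_sub_add_comm _ _ _ _
    · simp
    · simp
  map_smul' c x := by
    ext i : 1
    fin_cases i <;> simp [smul_sub, smul_comm c]
  left_inv x := by
    have h : (Real.exp (-(s / 2)) : ℂ) * (Real.exp (s / 2) : ℂ) = 1 := by
      rw [← Complex.ofReal_mul, ← Real.exp_add]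
      simp
    simp only [Matrix.cons_val, smul_smul, h]
    simp
  right_inv y := by
    have h : (Real.exp (s / 2) : ℂ) * (Real.exp (-(s / 2)) : ℂ) = 1 := by
      rw [← Complex.ofReal_mul, ← Real.exp_add]
      simp
    ext i : 1
    fin_cases i
    · simp
    · simp
    · simp only [smul_smul, h]
      simp
    · simp
  continuous_toFun := by
    refine (PiLp.continuous_toLp 2 _).comp (continuous_pi fun i => ?_)
    fin_cases i <;> simp <;> fun_prop
  continuous_invFun := by fun_prop

/-- The shift cancels `-E₁ eˢ (v, w)` and leaves one copy of `(v, w)`, the first component of the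
energy inner product. -/
theorem inner_energyMap {L : ℝ≥0} {f : ℝ → ℝ} (hf : LipschitzWith L f) (s d : ℝ)
    (v w : OscillatorSobolev d) :
    J₀ hf d s v w + ((E₁ d * Real.exp s + 1 : ℝ) : ℂ) *
      inner ℂ (OscillatorSobolev.toL2 d v) (OscillatorSobolev.toL2 d w) =
      inner ℂ (energyMap hf s d v) (energyMap hf s d w) := by
  have hexp : (Real.exp s : ℂ) = (Real.exp (s / 2) : ℂ) * (Real.exp (s / 2) : ℂ) := by
    rw [← Complex.ofReal_mul, ← Real.exp_add, add_halves]
  rw [PiLp.inner_apply, Fin.sum_univ_four]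
  change _ = inner ℂ (OscillatorSobolev.toL2 d v) (OscillatorSobolev.toL2 d w) +
    inner ℂ (OscillatorSobolev.dy d v - mulSigma hf s d 0 (OscillatorSobolev.dz d v))
      (OscillatorSobolev.dy d w - mulSigma hf s d 0 (OscillatorSobolev.dz d w)) +
    inner ℂ ((Real.exp (s / 2) : ℂ) • OscillatorSobolev.dz d v)
      ((Real.exp (s / 2) : ℂ) • OscillatorSobolev.dz d w) +
    inner ℂ ((1 / 4 : ℂ) • OscillatorSobolev.mulY d v) ((1 / 4 : ℂ) • OscillatorSobolev.mulY d w)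
  rw [inner_smul_left, inner_smul_right, inner_smul_left, inner_smul_right, Complex.conj_ofReal,
    J₀, LinearMap.mk₂'ₛₗ_apply, hexp]
  have h4 : (starRingEnd ℂ) (1 / 4) = 1 / 4 := by rw [map_div₀, map_one, map_ofNat]
  rw [h4, Complex.ofReal_add, Complex.ofReal_mul, hexp, Complex.ofReal_one]
  ring

/-- The form domain as a closed subspace of the energy space. -/
noncomputable def energyDomain {L : ℝ≥0} {f : ℝ → ℝ} (hf : LipschitzWith L f) (s d : ℝ) :
    Submodule ℂ (EnergySpace d) :=
  (OscillatorSobolev d).map (energyMap hf s d).toLinearEquiv.toLinearMap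

instance {L : ℝ≥0} {f : ℝ → ℝ} (hf : LipschitzWith L f) (s d : ℝ) :
    CompleteSpace (energyDomain hf s d) := by
  have h : IsClosed (energyDomain hf s d : Set (EnergySpace d)) :=
    (energyMap hf s d).toHomeomorph.isClosedMap _ (Submodule.isClosed_topologicalClosure _)
  exact h.completeSpace_coe

/-- The form domain and its image in the energy space. -/
noncomputable def energyEquiv {L : ℝ≥0} {f : ℝ → ℝ} (hf : LipschitzWith L f) (s d : ℝ) :
    OscillatorSobolev d ≃ₗ[ℂ] energyDomain hf s d :=
  (energyMap hf s d).toLinearEquiv.submoduleMap (OscillatorSobolev d)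

/-- The embedding of the form domain in `𝓗_0`. -/
noncomputable def energyEmbedding {L : ℝ≥0} {f : ℝ → ℝ} (hf : LipschitzWith L f) (s d : ℝ) :
    energyDomain hf s d →L[ℂ] WeightedL2 d 0 :=
  (PiLp.proj 2 (fun _ : Fin 4 => WeightedL2 d 0) 0) ∘L (energyDomain hf s d).subtypeL

theorem energyEmbedding_apply {L : ℝ≥0} {f : ℝ → ℝ} (hf : LipschitzWith L f) (s d : ℝ)
    (v : OscillatorSobolev d) :
    OscillatorSobolev.toL2 d v = energyEmbedding hf s d (energyEquiv hf s d v) := rfl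

theorem isCompactOperator_energyEmbedding {L : ℝ≥0} {f : ℝ → ℝ} (hf : LipschitzWith L f) (s : ℝ)
    {d : ℝ} (hd : 0 < d) : IsCompactOperator (energyEmbedding hf s d) := by
  refine isCompactOperator_of_forall_sq_norm_le _ fun ε hε => ?_
  set N : ℝ := ‖((energyMap hf s d).symm : EnergySpace d →L[ℂ]
    WeightedL2 d 0 × WeightedL2 d 0 × WeightedL2 d 0 × WeightedL2 d 0)‖
  -- Each of the three components in Rellich's inequality is at most `N` times the energy norm,
  -- whence `3 N²`; the `+ 1` keeps the denominator positive.
  obtain ⟨ι, _, g, hg⟩ := OscillatorSobolev.exists_norm_sq_toL2_le hd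
    (ε := ε / (3 * N ^ 2 + 1)) (by positivity)
  refine ⟨ι, inferInstance, fun i => innerSL ℂ (g i) ∘L energyEmbedding hf s d, fun w => ?_⟩
  obtain ⟨v, rfl⟩ := (energyEquiv hf s d).surjective w
  have hv := hg v
  rw [energyEmbedding_apply hf s d v] at hv
  refine hv.trans (add_le_add ?_ le_rfl)
  have hb : ‖(v : WeightedL2 d 0 × WeightedL2 d 0 × WeightedL2 d 0 × WeightedL2 d 0)‖ ≤
      N * ‖energyEquiv hf s d v‖ := by
    have := ((energyMap hf s d).symm : EnergySpace d →L[ℂ]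
    WeightedL2 d 0 × WeightedL2 d 0 × WeightedL2 d 0 × WeightedL2 d 0).le_opNorm (energyMap hf s d v)
    rwa [ContinuousLinearEquiv.coe_coe, ContinuousLinearEquiv.symm_apply_apply] at this
  have h2 := (norm_snd_le v.1).trans hb
  have h1 : ‖OscillatorSobolev.dy d v‖ ≤ N * ‖energyEquiv hf s d v‖ := (norm_fst_le v.1.2).trans h2
  have h3 := (norm_snd_le v.1.2).trans h2
  have h4 : ‖OscillatorSobolev.dz d v‖ ≤ N * ‖energyEquiv hf s d v‖ :=
    (norm_fst_le v.1.2.2).trans h3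
  have h5 : ‖OscillatorSobolev.mulY d v‖ ≤ N * ‖energyEquiv hf s d v‖ :=
    (norm_snd_le v.1.2.2).trans h3
  rw [div_mul_eq_mul_div, div_le_iff₀ (by positivity), mul_assoc]
  refine mul_le_mul_of_nonneg_left ?_ hε.le
  have e1 := pow_le_pow_left₀ (norm_nonneg _) h1 2
  have e2 := pow_le_pow_left₀ (norm_nonneg _) h4 2
  have e3 := pow_le_pow_left₀ (norm_nonneg _) h5 2
  nlinarith [sq_nonneg ‖energyEquiv hf s d v‖]

end ShearedStrip

/-! ### The Gaussian transformation between the weighted and unweighted problems -/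

namespace ShearedStrip

open UnboundedOperator

theorem measurable_density (k : ℤ) :
    Measurable fun p : ℝ × ℝ => ENNReal.ofReal (K p.1 ^ k) := by
  unfold K
  fun_prop

/-- The densities are strictly positive, so all weights have the same null sets and
almost-everywhere identities pass between them. -/
theorem weightMeasure_absolutelyContinuous (d : ℝ) (k l : ℤ) :
    weightMeasure d k ≪ weightMeasure d l :=
  (withDensity_absolutelyContinuous _ _).trans
    (withDensity_absolutelyContinuous' (measurable_density l).aemeasurable
      (Filter.Eventually.of_forall fun p => by
        rw [ENNReal.ofReal_ne_zero_iff]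
        exact zpow_pos (Real.exp_pos _) _))

theorem K_zpow (k : ℤ) (y : ℝ) : K y ^ k = Real.exp (k * (y ^ 2 / 4)) := by
  rw [K, ← Real.rpow_intCast, ← Real.exp_mul, mul_comm]

/-- Multiplication by a Gaussian factor changes the weight. -/
theorem eLpNorm_exp_mul {d c : ℝ} {k l : ℤ} (h : 8 * c + l = k) (w : ℝ × ℝ → ℂ) :
    eLpNorm (fun p => (Real.exp (c * p.1 ^ 2) : ℂ) * w p) 2 (weightMeasure d l) =
      eLpNorm w 2 (weightMeasure d k) := by
  rw [eLpNorm_eq_lintegral_rpow_enorm_toReal (by norm_num) (by norm_num),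
    eLpNorm_eq_lintegral_rpow_enorm_toReal (by norm_num) (by norm_num)]
  congr 1
  rw [weightMeasure, weightMeasure,
    lintegral_withDensity_eq_lintegral_mul_non_measurable _ (measurable_density l)
      (Filter.Eventually.of_forall fun _ => ENNReal.ofReal_lt_top),
    lintegral_withDensity_eq_lintegral_mul_non_measurable _ (measurable_density k)
      (Filter.Eventually.of_forall fun _ => ENNReal.ofReal_lt_top)]
  refine lintegral_congr fun p => ?_
  simp only [Pi.mul_apply, ENNReal.toReal_ofNat, ENNReal.rpow_ofNat]
  rw [enorm_mul, mul_pow, ← mul_assoc]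
  congr 1
  rw [← ofReal_norm, Complex.norm_real, Real.norm_of_nonneg (Real.exp_pos _).le,
    ← ENNReal.ofReal_pow (Real.exp_pos _).le, ← ENNReal.ofReal_mul (by rw [K_zpow]; positivity),
    K_zpow, K_zpow, ← Real.exp_nat_mul, ← Real.exp_add]
  -- Comparing exponents, `2 c y² + l y²/4 = k y²/4` is the hypothesis `8 c + l = k`.
  congr 2
  rw [← h]
  push_cast
  ring

theorem memLp_exp_mul {d c : ℝ} {k l : ℤ} (h : 8 * c + l = k) (w : WeightedL2 d k) :
    MemLp (fun p => (Real.exp (c * p.1 ^ 2) : ℂ) * w p) 2 (weightMeasure d l) := by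
  refine ⟨?_, ?_⟩
  · refine AEStronglyMeasurable.mul (Continuous.aestronglyMeasurable (by fun_prop)) ?_
    exact (Lp.aestronglyMeasurable w).mono_ac (weightMeasure_absolutelyContinuous d l k)
  · rw [eLpNorm_exp_mul h]
    exact Lp.eLpNorm_lt_top w

/-- Multiplication by `exp (c y²)` as an isometry from `𝓗_k` to `𝓗_l`, where `8 c = k - l`. -/
noncomputable def expMul {c : ℝ} {k l : ℤ} (d : ℝ) (h : 8 * c + l = k) : WeightedL2 d k →ₗᵢ[ℂ] WeightedL2 d l where
  toFun w := (memLp_exp_mul h w).toLp _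
  map_add' v w := by
    rw [← MemLp.toLp_add]
    refine MemLp.toLp_congr _ _ ?_
    filter_upwards [(weightMeasure_absolutelyContinuous d l k).ae_eq (Lp.coeFn_add v w)] with p hp
    simp only [Pi.add_apply, hp]
    ring
  map_smul' a w := by
    rw [RingHom.id_apply, ← MemLp.toLp_const_smul]
    refine MemLp.toLp_congr _ _ ?_
    filter_upwards [(weightMeasure_absolutelyContinuous d l k).ae_eq (Lp.coeFn_smul a w)] with p hp
    simp only [Pi.smul_apply, hp, smul_eq_mul]
    ring
  norm_map' w := by
    change ‖(memLp_exp_mul h w).toLp _‖ = _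
    rw [Lp.norm_toLp, eLpNorm_exp_mul h, Lp.norm_def]

theorem coeFn_expMul {d c : ℝ} {k l : ℤ} (h : 8 * c + l = k) (w : WeightedL2 d k) :
    expMul d h w =ᵐ[weightMeasure d l] fun p => (Real.exp (c * p.1 ^ 2) : ℂ) * w p :=
  MemLp.coeFn_toLp (memLp_exp_mul h w)

theorem expMul_expMul {d c c' : ℝ} {k l : ℤ} (h : 8 * c + l = k) (h' : 8 * c' + k = l)
    (w : WeightedL2 d k) : expMul d h' (expMul d h w) = w := by
  refine Lp.ext ?_
  filter_upwards [coeFn_expMul h' (expMul d h w),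
    (weightMeasure_absolutelyContinuous d k l).ae_eq (coeFn_expMul h w)] with p h1 h2
  rw [h1, h2, ← mul_assoc, ← Complex.ofReal_mul, ← Real.exp_add,
    show c' * p.1 ^ 2 + c * p.1 ^ 2 = 0 by
      rw [← add_mul, show c' + c = 0 by linarith, zero_mul], Real.exp_zero, Complex.ofReal_one,
    one_mul]

/-- `w ↦ exp (y² / 8) w` as an isometry from `𝓗_1` to `𝓗_0`. -/
noncomputable def gaussMul (d : ℝ) : WeightedL2 d 1 →ₗᵢ[ℂ] WeightedL2 d 0 :=
  expMul d (c := 1 / 8) (by norm_num)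

/-- `v ↦ exp (-y² / 8) v` as an isometry from `𝓗_0` to `𝓗_1`. -/
noncomputable def gaussDiv (d : ℝ) : WeightedL2 d 0 →ₗᵢ[ℂ] WeightedL2 d 1 :=
  expMul d (c := -(1 / 8)) (by norm_num)

theorem gaussDiv_gaussMul (d : ℝ) (w : WeightedL2 d 1) : gaussDiv d (gaussMul d w) = w :=
  expMul_expMul _ _ _

theorem gaussMul_gaussDiv (d : ℝ) (v : WeightedL2 d 0) : gaussMul d (gaussDiv d v) = v :=
  expMul_expMul _ _ _

/-- The unitary operator `w ↦ exp (y² / 8) w`. -/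
noncomputable def gaussEquiv (d : ℝ) : WeightedL2 d 1 ≃ₗᵢ[ℂ] WeightedL2 d 0 where
  toLinearEquiv := LinearEquiv.ofLinearMap (gaussMul d).toLinearMap (gaussDiv d).toLinearMap
    (LinearMap.ext (gaussMul_gaussDiv d)) (LinearMap.ext (gaussDiv_gaussMul d))
  norm_map' := (gaussMul d).norm_map

theorem coeFn_gaussEquiv (d : ℝ) (w : WeightedL2 d 1) :
    gaussEquiv d w =ᵐ[weightMeasure d 0] fun p => (Real.exp (p.1 ^ 2 / 8) : ℂ) * w p := by
  filter_upwards [coeFn_expMul (d := d) (k := 1) (l := 0) (c := 1 / 8) (by norm_num) w] with p hp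
  rw [show p.1 ^ 2 / 8 = 1 / 8 * p.1 ^ 2 by ring]
  exact hp

theorem coeFn_gaussEquiv_symm (d : ℝ) (v : WeightedL2 d 0) :
    (gaussEquiv d).symm v =ᵐ[weightMeasure d 1]
      fun p => (Real.exp (-(1 / 8) * p.1 ^ 2) : ℂ) * v p :=
  coeFn_expMul (c := -(1 / 8)) (k := 0) (l := 1) (by norm_num) v

theorem gaussEquiv_symm_mulSigma {L : ℝ≥0} {f : ℝ → ℝ} (hf : LipschitzWith L f) (s d : ℝ)
    (v : WeightedL2 d 0) : (gaussEquiv d).symm (mulSigma hf s d 0 v) =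
      mulSigma hf s d 1 ((gaussEquiv d).symm v) := by
  refine Lp.ext ?_
  filter_upwards [coeFn_gaussEquiv_symm d (mulSigma hf s d 0 v), coeFn_gaussEquiv_symm d v,
    coeFn_mulSigma hf s d 1 ((gaussEquiv d).symm v),
    (weightMeasure_absolutelyContinuous d 1 0).ae_eq (coeFn_mulSigma hf s d 0 v)]
    with p h1 h2 h3 h4
  rw [h1, h3, h2, h4]
  ring

/-- Multiplication of test functions by `exp (c y²)`. -/
noncomputable def expTest {d : ℝ} (c : ℝ) (φ : 𝓓(strip d, ℂ)) : 𝓓(strip d, ℂ) where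
  toFun p := (Real.exp (c * p.1 ^ 2) : ℂ) * φ p
  contDiff' := by
    refine ContDiff.mul ?_ φ.contDiff
    exact Complex.ofRealCLM.contDiff.comp
      (Real.contDiff_exp.comp (contDiff_const.mul (contDiff_fst.pow 2)))
  hasCompactSupport' := φ.hasCompactSupport.mul_left
  tsupport_subset' := (tsupport_mul_subset_right).trans φ.tsupport_subset

theorem expTest_apply {d : ℝ} (c : ℝ) (φ : 𝓓(strip d, ℂ)) (p : ℝ × ℝ) :
    expTest c φ p = (Real.exp (c * p.1 ^ 2) : ℂ) * φ p := rfl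

theorem expTest_expTest_neg {d : ℝ} (c : ℝ) (φ : 𝓓(strip d, ℂ)) :
    expTest c (expTest (-c) φ) = φ := by
  ext p
  rw [expTest_apply, expTest_apply, ← mul_assoc, ← Complex.ofReal_mul, ← Real.exp_add]
  simp

theorem partialTest_fst_expTest {d : ℝ} (c : ℝ) (φ : 𝓓(strip d, ℂ)) (p : ℝ × ℝ) :
    partialTest d (1, 0) (expTest c φ) p =
      (Real.exp (c * p.1 ^ 2) : ℂ) * (partialTest d (1, 0) φ p + 2 * c * (p.1 * φ p)) := by
  have h1 : HasDerivAt (fun t : ℝ => ((Real.exp (c * t ^ 2) : ℝ) : ℂ))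
      ((Real.exp (c * p.1 ^ 2) * (c * (2 * p.1)) : ℝ) : ℂ) p.1 := by
    have := (((hasDerivAt_pow 2 p.1).const_mul c).exp).ofReal_comp
    simpa using this
  have h2 := h1.mul (hasDerivAt_testFunction_fst φ p.1 p.2)
  rw [(hasDerivAt_testFunction_fst (expTest c φ) p.1 p.2).unique h2]
  push_cast
  ring

theorem partialTest_snd_expTest {d : ℝ} (c : ℝ) (φ : 𝓓(strip d, ℂ)) (p : ℝ × ℝ) :
    partialTest d (0, 1) (expTest c φ) p =
      (Real.exp (c * p.1 ^ 2) : ℂ) * partialTest d (0, 1) φ p :=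
  (hasDerivAt_testFunction_snd (expTest c φ) p.1 p.2).unique
    ((hasDerivAt_testFunction_snd φ p.1 p.2).const_mul (Real.exp (c * p.1 ^ 2) : ℂ))

theorem gaussEquiv_symm_ofTest {d : ℝ} (φ : 𝓓(strip d, ℂ)) :
    (gaussEquiv d).symm (ofTest d 0 φ) = ofTest d 1 (expTest (-(1 / 8)) φ) := by
  refine Lp.ext ?_
  filter_upwards [coeFn_gaussEquiv_symm d (ofTest d 0 φ), coeFn_ofTest d 1 (expTest (-(1 / 8)) φ),
    (weightMeasure_absolutelyContinuous d 1 0).ae_eq (coeFn_ofTest d 0 φ)] with p h1 h2 h3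
  rw [h1, h2, h3, expTest_apply]

theorem gaussEquiv_symm_dz_ofTest {d : ℝ} (φ : 𝓓(strip d, ℂ)) :
    (gaussEquiv d).symm (ofTest d 0 (partialTest d (0, 1) φ)) =
      ofTest d 1 (partialTest d (0, 1) (expTest (-(1 / 8)) φ)) := by
  rw [gaussEquiv_symm_ofTest]
  congr 1
  ext p
  rw [expTest_apply, partialTest_snd_expTest]

/-- Product rule: `∂_y (exp (-y²/8) φ) = exp (-y²/8) (∂_y φ - y φ / 4)`. -/
theorem gaussEquiv_symm_dy_ofTest {d : ℝ} (φ : 𝓓(strip d, ℂ)) :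
    (gaussEquiv d).symm (ofTest d 0 (partialTest d (1, 0) φ) -
      (1 / 4 : ℂ) • mulTest d 0 _ continuous_fst_ofReal φ) =
      ofTest d 1 (partialTest d (1, 0) (expTest (-(1 / 8)) φ)) := by
  have hac := weightMeasure_absolutelyContinuous d 1 0
  refine Lp.ext ?_
  filter_upwards [coeFn_gaussEquiv_symm d (ofTest d 0 (partialTest d (1, 0) φ) -
      (1 / 4 : ℂ) • mulTest d 0 _ continuous_fst_ofReal φ),
    coeFn_ofTest d 1 (partialTest d (1, 0) (expTest (-(1 / 8)) φ)),
    hac.ae_eq (Lp.coeFn_sub (ofTest d 0 (partialTest d (1, 0) φ))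
      ((1 / 4 : ℂ) • mulTest d 0 _ continuous_fst_ofReal φ)),
    hac.ae_eq (Lp.coeFn_smul (1 / 4 : ℂ) (mulTest d 0 _ continuous_fst_ofReal φ)),
    hac.ae_eq (coeFn_ofTest d 0 (partialTest d (1, 0) φ)),
    hac.ae_eq (coeFn_mulTest d 0 continuous_fst_ofReal φ)] with p h1 h2 h3 h4 h5 h6
  rw [h1, h2, h3, Pi.sub_apply, h4, Pi.smul_apply, h5, h6, partialTest_fst_expTest, smul_eq_mul]
  push_cast
  ring

/-- `(v, v_y, v_z, y v) ↦ (w, w_y, w_z)` for `w = exp (-y² / 8) v`. -/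
noncomputable def toWeightedFull (d : ℝ) :
    (WeightedL2 d 0 × WeightedL2 d 0 × WeightedL2 d 0 × WeightedL2 d 0) →L[ℂ]
      WeightedL2 d 1 × WeightedL2 d 1 × WeightedL2 d 1 where
  toFun x := ((gaussEquiv d).symm x.1, (gaussEquiv d).symm (x.2.1 - (1 / 4 : ℂ) • x.2.2.2),
    (gaussEquiv d).symm x.2.2.1)
  map_add' x y := by
    simp only [Prod.fst_add, Prod.snd_add, smul_add, add_sub_add_comm, map_add, Prod.mk_add_mk]
  map_smul' c x := by
    simp only [Prod.smul_fst, Prod.smul_snd, smul_comm (1 / 4 : ℂ) c, ← smul_sub, map_smul,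
      RingHom.id_apply, Prod.smul_mk]
  cont := by fun_prop

theorem toWeightedFull_ofTest {d : ℝ} (φ : 𝓓(strip d, ℂ)) :
    toWeightedFull d (OscillatorSobolev.ofTest d φ) =
      (ofTest d 1 (expTest (-(1 / 8)) φ),
        ofTest d 1 (partialTest d (1, 0) (expTest (-(1 / 8)) φ)),
        ofTest d 1 (partialTest d (0, 1) (expTest (-(1 / 8)) φ))) :=
  Prod.ext (gaussEquiv_symm_ofTest φ)
    (Prod.ext (gaussEquiv_symm_dy_ofTest φ) (gaussEquiv_symm_dz_ofTest φ))

theorem toWeightedFull_mem {d : ℝ} (v : OscillatorSobolev d) :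
    toWeightedFull d v ∈ Sobolev d 1 := by
  refine (OscillatorSobolev.denseRange_ofTest d).induction_on v ?_ fun φ => ?_
  · exact (Submodule.isClosed_topologicalClosure _).preimage
      ((toWeightedFull d).continuous.comp continuous_subtype_val)
  · rw [toWeightedFull_ofTest]
    exact Submodule.le_topologicalClosure _ ⟨expTest (-(1 / 8)) φ, rfl⟩

/-- The map `v ↦ exp (-y² / 8) v` between the form domains. -/
noncomputable def toWeighted (d : ℝ) : OscillatorSobolev d →ₗ[ℂ] Sobolev d 1 :=
  LinearMap.codRestrict _ ((toWeightedFull d).toLinearMap ∘ₗ (OscillatorSobolev d).subtype)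
    toWeightedFull_mem

/-- Expand the square; by `inner_dy_mulY` the cross term `-(1/2) Re (∂_y v, y v)` equals `‖v‖² / 4`.
All terms on the right are nonnegative, so the left side controls `‖y v‖`. -/
theorem norm_sq_dy_sub_mulY {d : ℝ} (v : OscillatorSobolev d) :
    ‖OscillatorSobolev.dy d v - (1 / 4 : ℂ) • OscillatorSobolev.mulY d v‖ ^ 2 =
      ‖OscillatorSobolev.dy d v‖ ^ 2 + ‖OscillatorSobolev.mulY d v‖ ^ 2 / 16 +
        ‖OscillatorSobolev.toL2 d v‖ ^ 2 / 4 := by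
  have h := congrArg Complex.re (OscillatorSobolev.inner_dy_mulY v v)
  have hs := inner_re_symm (𝕜 := ℂ) (OscillatorSobolev.mulY d v) (OscillatorSobolev.dy d v)
  have ht := inner_self_eq_norm_sq (𝕜 := ℂ) (OscillatorSobolev.toL2 d v)
  simp only [RCLike.re_to_complex] at hs ht
  simp only [Complex.add_re, Complex.zero_re] at h
  rw [norm_sub_sq (𝕜 := ℂ), inner_smul_right, norm_smul, mul_pow]
  have h4 : RCLike.re ((1 / 4 : ℂ) *
      inner ℂ (OscillatorSobolev.dy d v) (OscillatorSobolev.mulY d v)) =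
      1 / 4 * (inner ℂ (OscillatorSobolev.dy d v) (OscillatorSobolev.mulY d v)).re := by
    simp
  have h5 : ‖(1 / 4 : ℂ)‖ = 1 / 4 := by simp
  rw [h4, h5]
  linarith

theorem norm_le_toWeighted {d : ℝ} (v : OscillatorSobolev d) : ‖v‖ ≤ 4 * ‖toWeighted d v‖ := by
  set N := ‖toWeighted d v‖ with hN
  have hN0 : 0 ≤ N := norm_nonneg _
  have h2 : ‖(toWeighted d v).1.2‖ ≤ N := norm_snd_le (toWeighted d v).1
  have ht : ‖OscillatorSobolev.toL2 d v‖ ≤ N := by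
    have := norm_fst_le (toWeighted d v).1
    exact ((gaussEquiv d).symm.norm_map (OscillatorSobolev.toL2 d v)).symm.trans_le this
  have hz : ‖OscillatorSobolev.dz d v‖ ≤ N := by
    have := (norm_snd_le (toWeighted d v).1.2).trans h2
    exact ((gaussEquiv d).symm.norm_map (OscillatorSobolev.dz d v)).symm.trans_le this
  have hy : ‖OscillatorSobolev.dy d v - (1 / 4 : ℂ) • OscillatorSobolev.mulY d v‖ ≤ N := by
    have := (norm_fst_le (toWeighted d v).1.2).trans h2
    exact ((gaussEquiv d).symm.norm_map _).symm.trans_le this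
  -- Dropping nonnegative terms bounds `∂_y v` by `N`; the coefficient `1/16` of `‖y v‖²` yields the
  -- constant 4.
  have hsq := norm_sq_dy_sub_mulY v
  have hle := pow_le_pow_left₀ (norm_nonneg _) hy 2
  have h1 : ‖OscillatorSobolev.dy d v‖ ≤ N := by
    refine abs_le_of_sq_le_sq' ?_ hN0 |>.2
    nlinarith [sq_nonneg ‖OscillatorSobolev.mulY d v‖, sq_nonneg ‖OscillatorSobolev.toL2 d v‖]
  have h3 : ‖OscillatorSobolev.mulY d v‖ ≤ 4 * N := by
    refine abs_le_of_sq_le_sq' ?_ (by positivity) |>.2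
    nlinarith [sq_nonneg ‖OscillatorSobolev.dy d v‖, sq_nonneg ‖OscillatorSobolev.toL2 d v‖]
  have h4 : N ≤ 4 * N := by linarith
  exact norm_prod_le_iff.2 ⟨ht.trans h4, norm_prod_le_iff.2 ⟨h1.trans h4,
    norm_prod_le_iff.2 ⟨hz.trans h4, h3⟩⟩⟩

/-- The range is closed, since the map is bounded below on a complete space, and dense, since each
test function `φ` is the image of `exp (y²/8) φ`. -/
theorem toWeighted_surjective (d : ℝ) : Function.Surjective (toWeighted d) := by
  have hcont : Continuous (toWeighted d) :=
    ((toWeightedFull d).continuous.comp continuous_subtype_val).subtype_mk _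
  have : CompleteSpace (OscillatorSobolev d) :=
    (Submodule.isClosed_topologicalClosure _).completeSpace_coe
  have hcl : IsClosed (Set.range (toWeighted d)) :=
    (AddMonoidHomClass.antilipschitz_of_bound (toWeighted d) (K := 4)
      norm_le_toWeighted).isClosed_range
      ((⟨toWeighted d, hcont⟩ : OscillatorSobolev d →L[ℂ] Sobolev d 1).uniformContinuous)
  have hd : DenseRange (toWeighted d) := by
    refine Subtype.dense_iff.2 fun x hx => ?_
    refine closure_mono ?_ hx
    rintro _ ⟨φ, rfl⟩
    refine ⟨_, ⟨OscillatorSobolev.ofTest d (expTest (1 / 8) φ), rfl⟩, ?_⟩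
    have h : expTest (-(1 / 8)) (expTest (1 / 8) φ) = φ := by
      simpa using expTest_expTest_neg (-(1 / 8)) φ
    have := toWeightedFull_ofTest (expTest (1 / 8) φ)
    rw [h] at this
    exact this
  exact Set.range_eq_univ.1 (hcl.closure_eq ▸ hd.closure_range)

/-- The transformed derivative is `∂_y v - σ_s ∂_z v - y v / 4`. Its square gives the term `(y v, y
w) / 16`, while its cross terms reduce to `(v, w) / 4`, cancelling the `-1/4` of `J⁽¹⁾_s`. -/
theorem J₁_toWeighted {L : ℝ≥0} {f : ℝ → ℝ} (hf : LipschitzWith L f) (d s : ℝ)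
    (v w : OscillatorSobolev d) :
    J₁ hf d s (toWeighted d v) (toWeighted d w) = J₀ hf d s v w := by
  have hD : ∀ v : OscillatorSobolev d, Sobolev.dy d 1 (toWeighted d v) -
      mulSigma hf s d 1 (Sobolev.dz d 1 (toWeighted d v)) = (gaussEquiv d).symm
        ((OscillatorSobolev.dy d v - mulSigma hf s d 0 (OscillatorSobolev.dz d v)) -
          (1 / 4 : ℂ) • OscillatorSobolev.mulY d v) := fun v => by
    change (gaussEquiv d).symm (OscillatorSobolev.dy d v - (1 / 4 : ℂ) •
      OscillatorSobolev.mulY d v) - mulSigma hf s d 1 ((gaussEquiv d).symm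
        (OscillatorSobolev.dz d v)) = _
    rw [← gaussEquiv_symm_mulSigma, ← map_sub, sub_right_comm]
  have hz : ∀ v : OscillatorSobolev d, Sobolev.dz d 1 (toWeighted d v) =
      (gaussEquiv d).symm (OscillatorSobolev.dz d v) := fun v => rfl
  have ht : ∀ v : OscillatorSobolev d, Sobolev.toL2 d 1 (toWeighted d v) =
      (gaussEquiv d).symm (OscillatorSobolev.toL2 d v) := fun v => rfl
  rw [J₀, J₁, LinearMap.mk₂'ₛₗ_apply, LinearMap.mk₂'ₛₗ_apply, hD, hD, hz, hz, ht, ht]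
  simp only [LinearIsometryEquiv.inner_map_map]
  have h1 := OscillatorSobolev.inner_dy_mulY v w
  have h2 := OscillatorSobolev.inner_dz_mulY hf s v w
  have h4 : (starRingEnd ℂ) (1 / 4) = 1 / 4 := by rw [map_div₀, map_one, map_ofNat]
  simp only [inner_sub_left, inner_sub_right, inner_smul_left, inner_smul_right, h4] at h1 h2 ⊢
  linear_combination (-1 / 4) * h1 + (1 / 4) * h2

end ShearedStrip

/-! ### Transport of form graphs -/

namespace UnboundedOperator

variable {H H' : Type*} [NormedAddCommGroup H] [InnerProductSpace ℂ H] [NormedAddCommGroup H']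
  [InnerProductSpace ℂ H'] {V V' : Type*} [AddCommGroup V] [Module ℂ V] [AddCommGroup V']
  [Module ℂ V']

/-- The graph depends on the form domain only through its image in `H`. -/
theorem formGraph_congr {j : V →ₗ[ℂ] H} {a : V →ₗ⋆[ℂ] V →ₗ[ℂ] ℂ} {j' : V' →ₗ[ℂ] H}
    {a' : V' →ₗ⋆[ℂ] V' →ₗ[ℂ] ℂ} (Ψ : V → V') (hΨ : Function.Surjective Ψ)
    (hj : ∀ v, j' (Ψ v) = j v) (ha : ∀ v w, a' (Ψ v) (Ψ w) = a v w) :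
    formGraph j' a' = formGraph j a := by
  ext ⟨x, F⟩
  constructor
  · rintro ⟨u', hu, h⟩
    obtain ⟨u, rfl⟩ := hΨ u'
    exact ⟨u, (hj u).symm.trans hu, fun v => by rw [← ha, h, hj]⟩
  · rintro ⟨u, hu, h⟩
    refine ⟨Ψ u, (hj u).trans hu, fun v' => ?_⟩
    obtain ⟨v, rfl⟩ := hΨ v'
    rw [ha, h, hj]

theorem mem_formGraph_unitary (U : H ≃ₗᵢ[ℂ] H') (j : V →ₗ[ℂ] H') (a : V →ₗ⋆[ℂ] V →ₗ[ℂ] ℂ)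
    (w g : H) :
    (w, g) ∈ formGraph (U.symm.toLinearEquiv.toLinearMap ∘ₗ j) a ↔
      (U w, U g) ∈ formGraph j a := by
  have h : ∀ v : V, inner ℂ (U.symm (j v)) g = inner ℂ (j v) (U g) := fun v => by
    rw [← U.inner_map_map, U.apply_symm_apply]
  refine exists_congr fun u => and_congr ?_ (forall_congr' fun v => ?_)
  · exact U.symm_apply_eq
  · exact Eq.congr_right (h v)

end UnboundedOperator

/-! ### Conclusion for both operators -/

namespace ShearedStrip

open UnboundedOperator

theorem T₀_spec {L : ℝ≥0} {f : ℝ → ℝ} (hf : LipschitzWith L f) {d : ℝ} (hd : 0 < d) (s : ℝ) :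
    ((T₀ hf d s).graph = formGraph (OscillatorSobolev.toL2 d) (J₀ hf d s) ∧
      IsSelfAdjoint (T₀ hf d s)) ∧
      HasCompactResolvent (T₀ hf d s) ∧ HasPurelyDiscreteSpectrum (T₀ hf d s) :=
  formOperator_spec (energyEmbedding hf s d) (energyEquiv hf s d) (energyEmbedding_apply hf s d)
    (inner_energyMap hf s d) (isCompactOperator_energyEmbedding hf s hd)
    (OscillatorSobolev.toL2_injective d) (OscillatorSobolev.denseRange_toL2 d)

/-- The embedding of the oscillator form domain in `𝓗_1`. -/
noncomputable def weightedEmbedding (d : ℝ) : OscillatorSobolev d →ₗ[ℂ] WeightedL2 d 1 :=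
  (gaussEquiv d).symm.toLinearEquiv.toLinearMap ∘ₗ OscillatorSobolev.toL2 d

theorem formGraph_J₁ {L : ℝ≥0} {f : ℝ → ℝ} (hf : LipschitzWith L f) (d s : ℝ) :
    formGraph (Sobolev.toL2 d 1) (J₁ hf d s) = formGraph (weightedEmbedding d) (J₀ hf d s) :=
  formGraph_congr (toWeighted d) (toWeighted_surjective d) (fun _ => rfl) (J₁_toWeighted hf d s)

/-- By `formGraph_J₁` the operator also comes from `J⁽⁰⁾_s` on the oscillator domain embedded in
`𝓗_1`. The same energy space serves, its embedding followed by the unitary `exp (-y²/8)`, with the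
same shift. -/
theorem T₁_spec {L : ℝ≥0} {f : ℝ → ℝ} (hf : LipschitzWith L f) {d : ℝ} (hd : 0 < d) (s : ℝ) :
    ((T₁ hf d s).graph = formGraph (Sobolev.toL2 d 1) (J₁ hf d s) ∧
      IsSelfAdjoint (T₁ hf d s)) ∧
      HasCompactResolvent (T₁ hf d s) ∧ HasPurelyDiscreteSpectrum (T₁ hf d s) := by
  have hT : T₁ hf d s = formOperator (weightedEmbedding d) (J₀ hf d s) := by
    rw [T₁, formOperator, formOperator, formGraph_J₁]
  rw [hT, formGraph_J₁]
  have hC : IsCompactOperator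
      (((gaussEquiv d).symm.toContinuousLinearEquiv : WeightedL2 d 0 →L[ℂ] WeightedL2 d 1) ∘L
        energyEmbedding hf s d) :=
    (isCompactOperator_energyEmbedding hf s hd).clm_comp
      ((gaussEquiv d).symm.toContinuousLinearEquiv : WeightedL2 d 0 →L[ℂ] WeightedL2 d 1)
  refine formOperator_spec (l := E₁ d * Real.exp s + 1)
    (((gaussEquiv d).symm.toContinuousLinearEquiv : WeightedL2 d 0 →L[ℂ] WeightedL2 d 1) ∘L
      energyEmbedding hf s d) (energyEquiv hf s d) (fun v => rfl) (fun v u => ?_)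
    hC ?_ ?_
  · refine Eq.trans ?_ (inner_energyMap hf s d v u)
    congr 2
    exact (gaussEquiv d).symm.inner_map_map _ _
  · exact (gaussEquiv d).symm.injective.comp (OscillatorSobolev.toL2_injective d)
  · exact (gaussEquiv d).symm.surjective.denseRange.comp (OscillatorSobolev.denseRange_toL2 d)
      (gaussEquiv d).symm.continuous

end ShearedStrip

open UnboundedOperator ShearedStrip in
theorem mainTheorem7 (d : ℝ) (hd : 0 < d) (f : ℝ → ℝ) {L : ℝ≥0} (hf : LipschitzWith L f)
    (hf' : HasCompactSupport (deriv f)) (s : ℝ) (hs : 0 ≤ s) :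
    -- the operators are well defined by their forms and self-adjoint
    ((T₁ hf d s).graph = formGraph (Sobolev.toL2 d 1) (J₁ hf d s) ∧ IsSelfAdjoint (T₁ hf d s)) ∧
    ((T₀ hf d s).graph = formGraph (OscillatorSobolev.toL2 d) (J₀ hf d s) ∧
      IsSelfAdjoint (T₀ hf d s)) ∧
    -- they are unitarily equivalent through `w ↦ exp (y² / 8) w`
    (∃ U : WeightedL2 d 1 ≃ₗᵢ[ℂ] WeightedL2 d 0,
      (∀ w : WeightedL2 d 1, ∀ᵐ p ∂volume.restrict (strip d : Set (ℝ × ℝ)),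
        U w p = (Real.exp (p.1 ^ 2 / 8) : ℂ) * w p) ∧
      ∀ w g : WeightedL2 d 1, (w, g) ∈ (T₁ hf d s).graph ↔ (U w, U g) ∈ (T₀ hf d s).graph) ∧
    -- compact resolvent and purely discrete spectrum
    (HasCompactResolvent (T₁ hf d s) ∧ HasPurelyDiscreteSpectrum (T₁ hf d s)) ∧
    (HasCompactResolvent (T₀ hf d s) ∧ HasPurelyDiscreteSpectrum (T₀ hf d s)) := by
  obtain ⟨h₁, h₁'⟩ := T₁_spec hf hd s
  obtain ⟨h₀, h₀'⟩ := T₀_spec hf hd s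
  refine ⟨h₁, h₀, ⟨gaussEquiv d, fun w => ?_, fun w g => ?_⟩, h₁', h₀'⟩
  · rw [← weightMeasure_zero]
    exact coeFn_gaussEquiv d w
  · rw [h₁.1, h₀.1, formGraph_J₁]
    exact mem_formGraph_unitary _ _ _ w g
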